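/- All algorithms are programs of a machine with finitely many bit stacks; a step is one elementary instruction, test or oracle call, and copying costs one step per bit. A randomized algorithm gets uniformly random bits as an input, a non-uniform one also gets an advice string of polynomial length depending only on the security parameter $\lambda$. Let $n, m, t : \mathbb{N} \to \mathbb{N}$ and $\varepsilon : \mathbb{N} \to [0,\infty)$ be functions of $\lambda$, and let $\{0,1\}^\lambda$ be the universe of keys. **Bloom filters.** A Bloom filter $\Pi = (C_r, Q)$ for sets of $n$ keys using $m$ bits of memory consists of a randomized polynomial-time algorithm $C_r$, which maps public parameters and a set $S \subseteq \{0,1\}^\lambda$ with $|S| = n(\lambda)$ (given as a list in any order) to a state of $m(\lambda)$ bits, and a deterministic polynomial-time algorithm $Q$, which maps a state and a key $x \in \{0,1\}^\lambda$ to $\top$ or $\bot$. An initial segment of the state may be designated as the secret key of the filter. $\Pi$ is an $(n,\varepsilon)$-Bloom filter if for all $\lambda$ and all $S \subseteq \{0,1\}^\lambda$ with $|S| = n(\lambda)$, over the coins of $C_r$, $\Pr[Q(x, C_r(S)) = \top] = 1$ for every $x \in S$ and $\Pr[Q(x, C_r(S)) = \top] \le \varepsilon(\lambda)$ for every $x \in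 \{0,1\}^\lambda \setminus S$. **Smash-Bloom and security.** A non-uniform probabilistic polynomial-time adversary $\mathcal{A}$, given $1^\lambda$, chooses a set $S \subseteq \{0,1\}^\lambda$ with $|S| = n(\lambda)$; a state is sampled from $C_r(S)$; then $\mathcal{A}$, given $1^\lambda$ and $S$, makes at most $t(\lambda)$ queries to the oracle $x \mapsto Q(x, \text{state})$ and arbitrarily many to an oracle that returns the state without the secret key, and outputs a key $k$. It wins if $k \notin S$, $k$ was not queried, and $Q(k, \text{state}) = \top$. $\Pi$ is $(n,t,\delta)$-secure if for every such $\mathcal{A}$, for all large enough $\lambda$, $\mathcal{A}$ wins with probability at most $\delta(\lambda)$. **Pseudorandom permutations.** A pseudorandom permutation is a length-preserving keyed function $F : \{0,1\}^* \times \{0,1\}^* \to \{0,1\}^*$ with every $F_\kappa$ one-to-one, with $F_\kappa(x)$ and $F_\kappa^{-1}(x)$ computable in polynomial time from $\kappa$ and $x$, such that for every non-uniform probabilistic polynomial-time $D$ there is a negligible function $\nu$ such that, for all $\lambda$, $$\bigl|\Pr[D^{F_\kappa, F_\kappa^{-1}}(1^\lambda) = 1] - \Pr[D^{f, f^{-1}}(1^\lambda)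 = 1]\bigr| \le \nu(\lambda)$$ for uniform $\kappa \in \{0,1\}^\lambda$ and a uniform permutation $f$ of $\{0,1\}^\lambda$. **Theorem.** Let $F$ be a pseudorandom permutation and let $\Pi = (C_r, Q)$ be an $(n, \varepsilon)$-Bloom filter using $m$ bits. Then there are a negligible function $\mathrm{negl}$ and an $(n,\varepsilon)$-Bloom filter $\Pi' = (C_r', Q')$ using $m + \lambda$ bits that is $(n, t, \varepsilon + \mathrm{negl}(\lambda))$-secure. Its state consists of a uniformly random secret key $\kappa \in \{0,1\}^\lambda$, followed by the $m$ bits $C_r(\{F_\kappa(x) : x \in S\})$, all of which are visible to the adversary; and $Q'(x, (\kappa, \sigma)) = Q(F_\kappa(x), \sigma)$. -/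

import Mathlib

open Filter

/-! ## Bit strings, probability, negligible functions -/

/-- `{0,1}^n`. -/
abbrev BitStr (n : ℕ) : Type := List.Vector Bool n

/-- The string `1^n`. -/
def unary (n : ℕ) : List Bool := List.replicate n true

/-- The probability of the event `E` when `ω` is uniform on the finite type `Ω`. -/
noncomputable def Pr {Ω : Type} [Finite Ω] (E : Ω → Prop) : ℝ :=
  (Nat.card {ω : Ω // E ω} : ℝ) / (Nat.card Ω : ℝ)

/-- `f` tends to zero faster than the inverse of every polynomial. -/
def Negligible (f : ℕ → ℝ) : Prop :=
  Asymptotics.SuperpolynomialDecay atTop (fun n : ℕ => (n : ℝ)) f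

/-! ## The machine model

Programs of a machine with finitely many stacks of bits, with access to oracles named by `ι`.
A deterministic algorithm without oracles is a program in `Prog Empty`. A randomized algorithm
receives a uniformly random string as one of its inputs; a non-uniform one also receives an
advice string that depends only on the security parameter. -/

inductive Prog (ι : Type) : Type where
  /-- do nothing -/
  | skip : Prog ι
  /-- push the bit `b` on register `r` -/
  | push (r : ℕ) (b : Bool) : Prog ι
  /-- remove the top bit of register `r`, if there is one -/
  | pop (r : ℕ) : Prog ι
  /-- overwrite register `dst` by the content of register `src` -/
  | copy (dst src : ℕ) : Prog ι
  /-- submit the content of register `r` to oracle `i` and overwrite `r` by the answer -/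
  | ask (i : ι) (r : ℕ) : Prog ι
  /-- run `p`, then `q` -/
  | seq (p q : Prog ι) : Prog ι
  /-- run `p`, `q` or `e` if the top bit of `r` is `1`, `0` or absent, respectively -/
  | cond (r : ℕ) (p q e : Prog ι) : Prog ι
  /-- run `p` as long as register `r` is not empty -/
  | loop (r : ℕ) (p : Prog ι) : Prog ι

/-- The content of the registers. -/
abbrev Store : Type := ℕ → List Bool

/-- `Exec O P s c log s'`: with oracles `O`, the program `P` started in `s` halts in `s'` after
`c` steps; `log` is the list of its oracle queries, in order. Copying costs one step per bit, and
everything else, an oracle call included, one step per instruction or test. -/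
inductive Exec {ι : Type} (O : ι → List Bool → List Bool) :
    Prog ι → Store → ℕ → List (ι × List Bool) → Store → Prop where
  | skip (s : Store) : Exec O Prog.skip s 1 [] s
  | push (s : Store) (r : ℕ) (b : Bool) :
      Exec O (Prog.push r b) s 1 [] (Function.update s r (b :: s r))
  | pop (s : Store) (r : ℕ) :
      Exec O (Prog.pop r) s 1 [] (Function.update s r (s r).tail)
  | copy (s : Store) (dst src : ℕ) :
      Exec O (Prog.copy dst src) s (1 + (s src).length) [] (Function.update s dst (s src))
  | ask (s : Store) (i : ι) (r : ℕ) :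
      Exec O (Prog.ask i r) s 1 [(i, s r)] (Function.update s r (O i (s r)))
  | seq {p q : Prog ι} {s s₁ s₂ : Store} {c₁ c₂ : ℕ} {l₁ l₂ : List (ι × List Bool)} :
      Exec O p s c₁ l₁ s₁ → Exec O q s₁ c₂ l₂ s₂ →
      Exec O (Prog.seq p q) s (c₁ + c₂) (l₁ ++ l₂) s₂
  | cond_true {r : ℕ} {p q e : Prog ι} {s s' : Store} {c : ℕ} {l : List (ι × List Bool)} :
      (s r).head? = some true → Exec O p s c l s' →
      Exec O (Prog.cond r p q e) s (1 + c) l s'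
  | cond_false {r : ℕ} {p q e : Prog ι} {s s' : Store} {c : ℕ} {l : List (ι × List Bool)} :
      (s r).head? = some false → Exec O q s c l s' →
      Exec O (Prog.cond r p q e) s (1 + c) l s'
  | cond_empty {r : ℕ} {p q e : Prog ι} {s s' : Store} {c : ℕ} {l : List (ι × List Bool)} :
      s r = [] → Exec O e s c l s' →
      Exec O (Prog.cond r p q e) s (1 + c) l s'
  | loop_done {r : ℕ} {p : Prog ι} {s : Store} :
      s r = [] → Exec O (Prog.loop r p) s 1 [] s
  | loop_step {r : ℕ} {p : Prog ι} {s s₁ s₂ : Store} {c₁ c₂ : ℕ}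
      {l₁ l₂ : List (ι × List Bool)} :
      s r ≠ [] → Exec O p s c₁ l₁ s₁ → Exec O (Prog.loop r p) s₁ c₂ l₂ s₂ →
      Exec O (Prog.loop r p) s (1 + c₁ + c₂) (l₁ ++ l₂) s₂

/-- `P.Run O xs c log out`: with the inputs `xs` in registers `0, 1, 2, …` and all other registers
empty, `P` halts after `c` steps with queries `log` and output `out` in register `0`. -/
def Prog.Run {ι : Type} (P : Prog ι) (O : ι → List Bool → List Bool) (xs : List (List Bool))
    (c : ℕ) (log : List (ι × List Bool)) (out : List Bool) : Prop :=
  ∃ s' : Store, Exec O P (fun i => xs.getD i []) c log s' ∧ s' 0 = out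

/-- `P` halts on the inputs `xs` within `T` steps. -/
def Prog.HaltsIn {ι : Type} (P : Prog ι) (O : ι → List Bool → List Bool) (xs : List (List Bool))
    (T : ℕ) : Prop :=
  ∃ c log out, P.Run O xs c log out ∧ c ≤ T

/-- The oracles of an algorithm that has none. -/
def noOracle : Empty → List Bool → List Bool := fun i => i.elim

/-- The algorithm `P` outputs `out` on the inputs `xs` within `T` steps. -/
def Prog.OutputsIn (P : Prog Empty) (xs : List (List Bool)) (out : List Bool) (T : ℕ) : Prop :=
  ∃ c log, P.Run noOracle xs c log out ∧ c ≤ T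

/-! ## Pseudorandom permutations -/

/-- A length-preserving keyed function all of whose sections `F_k` are one-to-one, together with
polynomial-time algorithms for `F_k(x)` and `F_k⁻¹(y)`. -/
structure KeyedPermutation where
  toFun : List Bool → List Bool → List Bool
  length_eq : ∀ k x, (toFun k x).length = x.length
  injective : ∀ k, Function.Injective (toFun k)
  polyTime : ∃ (P : Prog Empty) (p : Polynomial ℕ), ∀ k x,
    P.OutputsIn [k, x] (toFun k x) (p.eval (k.length + x.length))
  polyTime_inv : ∃ (P : Prog Empty) (p : Polynomial ℕ), ∀ k x,
    P.OutputsIn [k, toFun k x] x (p.eval (k.length + x.length))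

/-- The permutation `F_k` of `{0,1}^n`. -/
noncomputable def KeyedPermutation.perm (F : KeyedPermutation) (n : ℕ) (k : List Bool) :
    Equiv.Perm (BitStr n) :=
  Equiv.ofBijective (fun x => ⟨F.toFun k x.1, (F.length_eq k x.1).trans x.2⟩)
    (Finite.injective_iff_bijective.mp fun _ _ h =>
      Subtype.ext (F.injective k (congrArg Subtype.val h)))

/-- The two oracles of a distinguisher: a permutation and its inverse. -/
inductive PermOracle : Type where
  | forward : PermOracle
  | backward : PermOracle

/-- The oracles for `f ∈ Perm_n`; strings of a length other than `n` get the empty answer. -/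
def permOracle {n : ℕ} (f : Equiv.Perm (BitStr n)) : PermOracle → List Bool → List Bool
  | .forward, x => if h : x.length = n then (f ⟨x, h⟩).1 else []
  | .backward, x => if h : x.length = n then (f.symm ⟨x, h⟩).1 else []

/-- A non-uniform randomized oracle algorithm with input `1^n`: for each `n` an advice string and
a number of random bits. -/
structure Distinguisher where
  prog : Prog PermOracle
  advice : ℕ → List Bool
  coins : ℕ → ℕ

/-- The inputs of `D`, for security parameter `n` and random bits `r`. -/
def Distinguisher.inputs (D : Distinguisher) (n : ℕ) (r : BitStr (D.coins n)) :
    List (List Bool) :=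
  [unary n, D.advice n, r.1]

/-- `D` is a non-uniform probabilistic polynomial-time algorithm. -/
def Distinguisher.Efficient (D : Distinguisher) : Prop :=
  ∃ p : Polynomial ℕ, ∀ n : ℕ,
    (D.advice n).length ≤ p.eval n ∧ D.coins n ≤ p.eval n ∧
    ∀ (f : Equiv.Perm (BitStr n)) (r : BitStr (D.coins n)),
      D.prog.HaltsIn (permOracle f) (D.inputs n r) (p.eval n)

/-- `D` outputs `1` when its oracles are `f, f⁻¹` and its random bits are `r`. -/
def Distinguisher.Accepts (D : Distinguisher) (n : ℕ) (f : Equiv.Perm (BitStr n))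
    (r : BitStr (D.coins n)) : Prop :=
  ∃ c log, D.prog.Run (permOracle f) (D.inputs n r) c log [true]

/-- `F` is a pseudorandom permutation: with a uniform key in `{0,1}^n`, efficient distinguishers
cannot tell `F_k, F_k⁻¹` from a uniform `f ∈ Perm_n` and its inverse. -/
def KeyedPermutation.IsPRP (F : KeyedPermutation) : Prop :=
  ∀ D : Distinguisher, D.Efficient → ∃ negl : ℕ → ℝ, Negligible negl ∧ ∀ n : ℕ,
    |Pr (fun ω : BitStr n × BitStr (D.coins n) => D.Accepts n (F.perm n ω.1.1) ω.2) -
      Pr (fun ω : Equiv.Perm (BitStr n) × BitStr (D.coins n) => D.Accepts n ω.1 ω.2)| ≤ negl n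

/-! ## Bloom filters

For security parameter `lam` the universe of keys is `{0,1}^lam`, the domain of a pseudorandom
permutation whose key has `lam` bits. Set size, memory size, number of queries and error are
functions of `lam`. -/

/-- A set of `n` keys, presented to an algorithm as a duplicate-free list in an arbitrary order. -/
def IsKeySet {lam : ℕ} (n : ℕ) (L : List (BitStr lam)) : Prop :=
  L.Nodup ∧ L.length = n

/-- The concatenation of the keys in `L`. -/
def encodeKeys {lam : ℕ} (L : List (BitStr lam)) : List Bool :=
  (L.map Subtype.val).flatten

/-- A Bloom filter for sets of `n lam` keys that uses `m lam` bits of memory: a randomized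
construction algorithm and a deterministic query algorithm, both polynomial-time. The memory
starts with `secret lam` bits that hold a secret key (there need not be any); the rest is the
internal state that is visible to an adversary. -/
structure BloomFilter (n m : ℕ → ℕ) where
  /-- the public parameters (besides `lam`) -/
  params : ℕ → List Bool
  /-- the number of random bits of the construction algorithm -/
  coins : ℕ → ℕ
  secret : ℕ → ℕ
  construct : (lam : ℕ) → List (BitStr lam) → BitStr (coins lam) → BitStr (m lam)
  query : (lam : ℕ) → BitStr (m lam) → BitStr lam → Bool
  secret_le : ∀ lam, secret lam ≤ m lam
  bounded : ∃ p : Polynomial ℕ, ∀ lam,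
    (params lam).length ≤ p.eval (lam + n lam) ∧ coins lam ≤ p.eval (lam + n lam)
  construct_polyTime : ∃ (P : Prog Empty) (p : Polynomial ℕ), ∀ lam L r, IsKeySet (n lam) L →
    P.OutputsIn [unary lam, params lam, encodeKeys L, r.1] (construct lam L r).1
      (p.eval (lam + n lam))
  query_polyTime : ∃ (P : Prog Empty) (p : Polynomial ℕ), ∀ lam st x,
    P.OutputsIn [unary lam, params lam, st.1, x.1] [query lam st x]
      (p.eval (lam + n lam + m lam))

/-- `B` is an `(n, ε)`-Bloom filter: completeness and soundness. -/
def BloomFilter.IsBF {n m : ℕ → ℕ} (B : BloomFilter n m) (ε : ℕ → ℝ) : Prop :=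
  ∀ (lam : ℕ) (L : List (BitStr lam)), IsKeySet (n lam) L →
    (∀ x ∈ L, Pr (fun r : BitStr (B.coins lam) =>
      B.query lam (B.construct lam L r) x = true) = 1) ∧
    (∀ x ∉ L, Pr (fun r : BitStr (B.coins lam) =>
      B.query lam (B.construct lam L r) x = true) ≤ ε lam)

/-! ## The Smash-Bloom game -/

/-- The two oracles of an adversary: queries to the filter, and its internal state. -/
inductive FilterOracle : Type where
  | query : FilterOracle
  | state : FilterOracle

/-- The oracles for the visible state `σ` and the answers `g`. -/
def filterOracle (σ : List Bool) (g : List Bool → Bool) : FilterOracle → List Bool → List Bool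
  | .query, x => [g x]
  | .state, _ => σ

/-- The answer of `B` with memory content `st` to the query `x`; strings that are not in the
universe get the answer `false`. -/
def BloomFilter.answer {n m : ℕ → ℕ} (B : BloomFilter n m) (lam : ℕ) (st : BitStr (m lam))
    (x : List Bool) : Bool :=
  if h : x.length = lam then B.query lam st ⟨x, h⟩ else false

/-- A non-uniform randomized adversary: `choose` picks the set, `attack` tries to find a false
positive. Both get `1^lam`, the advice and the random bits of the adversary; `attack` also gets
the set. -/
structure Adversary where
  choose : Prog Empty
  attack : Prog FilterOracle
  advice : ℕ → List Bool
  coins : ℕ → ℕ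

def Adversary.chooseInputs (A : Adversary) (lam : ℕ) (r : BitStr (A.coins lam)) :
    List (List Bool) :=
  [unary lam, A.advice lam, r.1]

def Adversary.attackInputs (A : Adversary) (lam : ℕ) (r : BitStr (A.coins lam))
    (L : List (BitStr lam)) : List (List Bool) :=
  [unary lam, A.advice lam, r.1, encodeKeys L]

/-- `A` runs in non-uniform probabilistic polynomial time when it plays against filters for sets
of `n lam` keys with `v lam` bits of visible state, whatever the answers to its queries are. -/
def Adversary.Efficient (A : Adversary) (n v : ℕ → ℕ) : Prop :=
  ∃ p : Polynomial ℕ, ∀ lam : ℕ,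
    (A.advice lam).length ≤ p.eval lam ∧ A.coins lam ≤ p.eval lam ∧
    (∀ r : BitStr (A.coins lam),
      A.choose.HaltsIn noOracle (A.chooseInputs lam r) (p.eval lam)) ∧
    (∀ (r : BitStr (A.coins lam)) (L : List (BitStr lam)) (σ : BitStr (v lam))
      (g : List Bool → Bool), IsKeySet (n lam) L →
      A.attack.HaltsIn (filterOracle σ.1 g) (A.attackInputs lam r L) (p.eval (lam + n lam)))

/-- The number of queries to the filter in a log. -/
def filterQueries (log : List (FilterOracle × List Bool)) : ℕ :=
  log.countP fun q => match q.1 with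
    | .query => true
    | .state => false

/-- `A` wins the game against `B` when the random bits are `rA` and `rB`: it chooses a set `L` of
`n lam` keys, makes at most `t lam` queries to the filter constructed for `L`, reads the visible
state as often as it likes, and outputs a key `k` outside `L` that it did not query and to which
the filter answers `true`. -/
def BloomFilter.SmashBloom {n m : ℕ → ℕ} (B : BloomFilter n m) (A : Adversary) (t : ℕ → ℕ)
    (lam : ℕ) (rA : BitStr (A.coins lam)) (rB : BitStr (B.coins lam)) : Prop :=
  ∃ L : List (BitStr lam), IsKeySet (n lam) L ∧
    (∃ c log, A.choose.Run noOracle (A.chooseInputs lam rA) c log (encodeKeys L)) ∧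
    ∃ (k : BitStr lam) (c : ℕ) (log : List (FilterOracle × List Bool)),
      A.attack.Run
        (filterOracle ((B.construct lam L rB).1.drop (B.secret lam))
          (B.answer lam (B.construct lam L rB)))
        (A.attackInputs lam rA L) c log k.1 ∧
      filterQueries log ≤ t lam ∧
      k ∉ L ∧ (FilterOracle.query, k.1) ∉ log ∧
      B.query lam (B.construct lam L rB) k = true

/-- `B` is `(n, t, δ)`-secure. -/
def BloomFilter.Secure {n m : ℕ → ℕ} (B : BloomFilter n m) (t : ℕ → ℕ) (δ : ℕ → ℝ) : Prop :=
  ∀ A : Adversary, A.Efficient n (fun lam => m lam - B.secret lam) →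
    ∀ᶠ lam : ℕ in atTop,
      Pr (fun ω : BitStr (A.coins lam) × BitStr (B.coins lam) =>
        B.SmashBloom A t lam ω.1 ω.2) ≤ δ lam

/-- `B'` is the filter `B` with every key `x` replaced by `F_κ(x)`, where the uniformly random
`κ ∈ {0,1}^lam` is the only secret part of the memory and is stored in front of the memory of
`B`. -/
def BloomFilter.IsPermuted {n m : ℕ → ℕ} (B' : BloomFilter n (fun lam => m lam + lam))
    (F : KeyedPermutation) (B : BloomFilter n m) : Prop :=
  ∀ lam : ℕ, B'.secret lam = lam ∧ B'.coins lam = lam + B.coins lam ∧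
    ∀ κ : BitStr lam,
      (∀ (L : List (BitStr lam)) (r : BitStr (B.coins lam)) (r' : BitStr (B'.coins lam)),
        r'.1 = κ.1 ++ r.1 →
        (B'.construct lam L r').1 = κ.1 ++ (B.construct lam (L.map (F.perm lam κ.1)) r).1) ∧
      (∀ (x : BitStr lam) (σ : BitStr (m lam)) (st : BitStr (m lam + lam)),
        st.1 = κ.1 ++ σ.1 →
        B'.query lam st x = B.query lam σ (F.perm lam κ.1 x))

/-! ## Determinism and resource bounds of executions -/

section Basics

variable {ι κ : Type}

/-! Suppose first that the keys are permuted by a uniformly random `f` instead of `F_κ`. The state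
depends on `f` only through the image of the set `S`, and an attack with few queries learns few
further facts about `f`. So the image of the key `k` that it outputs is an almost uniform point, and
soundness of the filter, which covers only points fixed before the coins are drawn, becomes
applicable. Counting makes this precise (`AttackData.card_breaks_mul_le`). Let the attack succeed
for `f` with output `k`, and let `y` be a value whose preimage is neither in `S` nor queried. Put `g
= swap (f k) y * f`. The attack cannot tell `g` from `f`, and `f k` is a false positive of the
filter for the keys `g(S)`. The map `(f, y) ↦ (g, f k)` is injective: the attack on `g` outputs `k`
again, `y = g k`, and undoing the transposition gives `f`. If `N` bounds the set size and the
running time, there are at least `2 ^ lam - 2 * N` such `y`; hence success has probability at most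
`ε + 4 N / 2 ^ lam` (`AttackData.Pr_breaks_le`). The step from `f` to `F_κ` is a reduction. A
distinguisher simulates filter and attack with its permutation oracle and checks whether the attack
succeeds. It is written out as a program: `Exec.compile` replaces oracle calls by programs, and
`Computes.distinguish` and `exists_distinguisher` give its correctness and running time. A single
negligible function must serve all adversaries. For a fixed attack program and polynomial bound,
everything else (advice, coins, set, coins of the filter) can be chosen almost worst for every `lam`
and given to the distinguisher as advice, so the advantage is negligible uniformly in these data
(`AttackData.exists_negligible_advantage`). There are only countably many pairs of a program and a
polynomial, and countably many negligible functions are eventually dominated by one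
(`exists_negligible_forall_eventually_le`). Security is an asymptotic requirement, so eventual
domination suffices. -/

theorem Exec.unique {O : ι → List Bool → List Bool} {P : Prog ι} {s s₁ : Store} {c₁ : ℕ}
    {l₁ : List (ι × List Bool)} (h : Exec O P s c₁ l₁ s₁) :
    ∀ {c₂ l₂ s₂}, Exec O P s c₂ l₂ s₂ → c₁ = c₂ ∧ l₁ = l₂ ∧ s₁ = s₂ := by
  induction h with
  | skip s => intro _ _ _ h; cases h; simp
  | push s r b => intro _ _ _ h; cases h; simp
  | pop s r => intro _ _ _ h; cases h; simp
  | copy s d r => intro _ _ _ h; cases h; simp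
  | ask s i r => intro _ _ _ h; cases h; simp
  | seq _ _ ih₁ ih₂ =>
    intro _ _ _ h
    cases h with
    | seq h₁ h₂ =>
      obtain ⟨rfl, rfl, rfl⟩ := ih₁ h₁
      obtain ⟨rfl, rfl, rfl⟩ := ih₂ h₂
      simp
  | cond_true hs _ ih =>
    intro _ _ _ h
    cases h with
    | cond_true _ h => obtain ⟨rfl, rfl, rfl⟩ := ih h; simp
    | cond_false hs' _ => rw [hs] at hs'; cases hs'
    | cond_empty hs' _ => rw [hs'] at hs; cases hs
  | cond_false hs _ ih =>
    intro _ _ _ h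
    cases h with
    | cond_true hs' _ => rw [hs] at hs'; cases hs'
    | cond_false _ h => obtain ⟨rfl, rfl, rfl⟩ := ih h; simp
    | cond_empty hs' _ => rw [hs'] at hs; cases hs
  | cond_empty hs _ ih =>
    intro _ _ _ h
    cases h with
    | cond_true hs' _ => rw [hs] at hs'; cases hs'
    | cond_false hs' _ => rw [hs] at hs'; cases hs'
    | cond_empty _ h => obtain ⟨rfl, rfl, rfl⟩ := ih h; simp
  | loop_done hs =>
    intro _ _ _ h
    cases h with
    | loop_done _ => simp
    | loop_step hs' _ _ => exact absurd hs hs'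
  | loop_step hs _ _ ih₁ ih₂ =>
    intro _ _ _ h
    cases h with
    | loop_done hs' => exact absurd hs' hs
    | loop_step _ h₁ h₂ =>
      obtain ⟨rfl, rfl, rfl⟩ := ih₁ h₁
      obtain ⟨rfl, rfl, rfl⟩ := ih₂ h₂
      simp

theorem Prog.Run.unique {O : ι → List Bool → List Bool} {P : Prog ι} {xs : List (List Bool)}
    {c₁ c₂ : ℕ} {l₁ l₂ : List (ι × List Bool)} {o₁ o₂ : List Bool}
    (h₁ : P.Run O xs c₁ l₁ o₁) (h₂ : P.Run O xs c₂ l₂ o₂) : c₁ = c₂ ∧ l₁ = l₂ ∧ o₁ = o₂ := by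
  obtain ⟨s₁, h₁, rfl⟩ := h₁
  obtain ⟨s₂, h₂, rfl⟩ := h₂
  obtain ⟨rfl, rfl, rfl⟩ := h₁.unique h₂
  simp

/-- An execution depends only on the answers to the queries that are made. -/
theorem Exec.congr_oracle {O O' : ι → List Bool → List Bool} {P : Prog ι} {s s' : Store} {c : ℕ}
    {l : List (ι × List Bool)} (h : Exec O P s c l s') (hO : ∀ q ∈ l, O q.1 q.2 = O' q.1 q.2) :
    Exec O' P s c l s' := by
  induction h with
  | skip s => exact .skip s
  | push s r b => exact .push s r b
  | pop s r => exact .pop s r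
  | copy s d r => exact .copy s d r
  | ask s i r =>
    have := hO (i, s r) (by simp)
    simp only at this
    rw [this]
    exact .ask s i r
  | seq _ _ ih₁ ih₂ =>
    exact .seq (ih₁ fun q hq => hO q (by simp [hq])) (ih₂ fun q hq => hO q (by simp [hq]))
  | cond_true hs _ ih => exact .cond_true hs (ih hO)
  | cond_false hs _ ih => exact .cond_false hs (ih hO)
  | cond_empty hs _ ih => exact .cond_empty hs (ih hO)
  | loop_done hs => exact .loop_done hs
  | loop_step hs _ _ ih₁ ih₂ =>
    exact .loop_step hs (ih₁ fun q hq => hO q (by simp [hq]))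
      (ih₂ fun q hq => hO q (by simp [hq]))

theorem Exec.length_log_le {O : ι → List Bool → List Bool} {P : Prog ι} {s s' : Store} {c : ℕ}
    {l : List (ι × List Bool)} (h : Exec O P s c l s') : l.length ≤ c := by
  induction h with
  | skip | push | pop | copy | loop_done => exact Nat.zero_le _
  | ask => exact le_rfl
  | seq | loop_step => rw [List.length_append]; omega
  | cond_true | cond_false | cond_empty => omega

theorem Store.length_update_le {s : Store} {M : ℕ} (hs : ∀ r, (s r).length ≤ M) (r : ℕ)
    {x : List Bool} (hx : x.length ≤ M) (r' : ℕ) : (Function.update s r x r').length ≤ M := by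
  rw [Function.update_apply]
  split_ifs
  exacts [hx, hs r']

/-- A push adds one bit at a cost of one step; copies and answers stay within the current bound. `M`
varies in the induction because the second half of a run starts from the bound reached by the first.
-/
theorem Exec.length_le {O : ι → List Bool → List Bool} {P : Prog ι} {s s' : Store} {c : ℕ}
    {l : List (ι × List Bool)} (h : Exec O P s c l s') :
    ∀ {M : ℕ}, (∀ i x, (O i x).length ≤ M) → (∀ r, (s r).length ≤ M) →
      ∀ r, (s' r).length ≤ M + c := by
  induction h with
  | skip s => intro M _ hs r; exact (hs r).trans (by omega)
  | push s r b =>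
    intro M _ hs
    exact Store.length_update_le (fun r => (hs r).trans (by omega)) r (by simp [hs r])
  | pop s r =>
    intro M _ hs
    exact Store.length_update_le (fun r => (hs r).trans (by omega)) r
      (by have := hs r; simp; omega)
  | copy s d r =>
    intro M _ hs
    exact Store.length_update_le (fun r => (hs r).trans (by omega)) d
      (by have := hs r; omega)
  | ask s i r =>
    intro M hO hs
    exact Store.length_update_le (fun r => (hs r).trans (by omega)) r
      (by have := hO i (s r); omega)
  | seq _ _ ih₁ ih₂ =>
    intro M hO hs r
    have := ih₂ (fun i x => (hO i x).trans (Nat.le_add_right _ _)) (ih₁ hO hs) r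
    omega
  | cond_true _ _ ih => intro M hO hs r; have := ih hO hs r; omega
  | cond_false _ _ ih => intro M hO hs r; have := ih hO hs r; omega
  | cond_empty _ _ ih => intro M hO hs r; have := ih hO hs r; omega
  | loop_done _ => intro M _ hs r; exact (hs r).trans (by omega)
  | loop_step _ _ _ ih₁ ih₂ =>
    intro M hO hs r
    have := ih₂ (fun i x => (hO i x).trans (Nat.le_add_right _ _)) (ih₁ hO hs) r
    omega

theorem List.length_getD_le_sum (xs : List (List Bool)) (i : ℕ) :
    (xs.getD i []).length ≤ (xs.map List.length).sum := by
  by_cases hi : i < xs.length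
  · rw [List.getD_eq_getElem _ _ hi]
    exact List.single_le_sum (by simp) _ (List.mem_map_of_mem (List.getElem_mem hi))
  · rw [List.getD_eq_default _ _ (not_lt.mp hi)]
    exact Nat.zero_le _

/-- Sizes that are not assumed to be polynomial are controlled through this: the memory size as the
output length of the construction, the set size as that of the choice of the adversary. -/
theorem Prog.OutputsIn.length_le {P : Prog Empty} {xs : List (List Bool)} {out : List Bool}
    {T : ℕ} (h : P.OutputsIn xs out T) : out.length ≤ (xs.map List.length).sum + T := by
  obtain ⟨c, l, ⟨s', h, rfl⟩, hc⟩ := h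
  exact (h.length_le (fun i => i.elim) (List.length_getD_le_sum xs) 0).trans (by omega)

end Basics

/-! ## Relocation and oracle substitution -/

section Relocation

variable {ι κ : Type}

/-- All registers used by the program are smaller than its width. -/
def Prog.width : Prog ι → ℕ
  | .skip => 0
  | .push r _ => r + 1
  | .pop r => r + 1
  | .copy d r => max d r + 1
  | .ask _ r => r + 1
  | .seq p q => max p.width q.width
  | .cond r p q e => max (r + 1) (max p.width (max q.width e.width))
  | .loop r p => max (r + 1) p.width

/-- Shift all registers by `b` and replace every oracle call by a program. -/
def Prog.compile (b : ℕ) (S : ι → ℕ → Prog κ) : Prog ι → Prog κ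
  | .skip => .skip
  | .push r x => .push (b + r) x
  | .pop r => .pop (b + r)
  | .copy d r => .copy (b + d) (b + r)
  | .ask i r => S i (b + r)
  | .seq p q => .seq (p.compile b S) (q.compile b S)
  | .cond r p q e => .cond (b + r) (p.compile b S) (q.compile b S) (e.compile b S)
  | .loop r p => .loop (b + r) (p.compile b S)

/-- On the registers below `G`, the program transforms `v` into `v'`, within `T` steps and
whatever the content of the other registers. -/
def Computes (O : ι → List Bool → List Bool) (G : ℕ) (P : Prog ι) (v : Store) (T : ℕ)
    (v' : Store) : Prop :=
  ∀ t : Store, (∀ i < G, t i = v i) →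
    ∃ c l t', Exec O P t c l t' ∧ c ≤ T ∧ ∀ i < G, t' i = v' i

namespace Computes

variable {O : ι → List Bool → List Bool} {G : ℕ} {P Q R : Prog ι} {v v₁ v₂ : Store}
  {T T₁ T₂ : ℕ}

theorem mono (h : Computes O G P v T₁ v₁) (hT : T₁ ≤ T₂) (hv : ∀ i < G, v₁ i = v₂ i) :
    Computes O G P v T₂ v₂ := by
  intro t ht
  obtain ⟨c, l, t', he, hc, ht'⟩ := h t ht
  exact ⟨c, l, t', he, hc.trans hT, fun i hi => (ht' i hi).trans (hv i hi)⟩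

theorem mono_cost (h : Computes O G P v T₁ v₁) (hT : T₁ ≤ T₂) : Computes O G P v T₂ v₁ :=
  h.mono hT fun _ _ => rfl

theorem congr_left (h : Computes O G P v₁ T v₂) (hv : ∀ i < G, v i = v₁ i) :
    Computes O G P v T v₂ :=
  fun t ht => h t fun i hi => (ht i hi).trans (hv i hi)

theorem congr_right (h : Computes O G P v T v₁) (hv : v₁ = v₂) : Computes O G P v T v₂ :=
  hv ▸ h

theorem skip (v : Store) : Computes O G .skip v 1 v :=
  fun t ht => ⟨_, _, _, .skip t, le_rfl, ht⟩

theorem agree_update {t : Store} {r : ℕ} {x y : List Bool} (ht : ∀ i < G, t i = v i)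
    (hxy : x = y) : ∀ i < G, Function.update t r x i = Function.update v r y i := by
  intro i hi
  simp only [Function.update_apply, hxy, ht i hi]

theorem push (v : Store) {r : ℕ} (hr : r < G) (b : Bool) :
    Computes O G (.push r b) v 1 (Function.update v r (b :: v r)) :=
  fun t ht => ⟨_, _, _, .push t r b, le_rfl, agree_update ht (by rw [ht r hr])⟩

theorem pop (v : Store) {r : ℕ} (hr : r < G) :
    Computes O G (.pop r) v 1 (Function.update v r (v r).tail) :=
  fun t ht => ⟨_, _, _, .pop t r, le_rfl, agree_update ht (by rw [ht r hr])⟩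

theorem copy (v : Store) (d : ℕ) {r : ℕ} (hr : r < G) :
    Computes O G (.copy d r) v (1 + (v r).length) (Function.update v d (v r)) :=
  fun t ht => ⟨_, _, _, .copy t d r, by rw [ht r hr], agree_update ht (by rw [ht r hr])⟩

theorem ask (v : Store) (i : ι) {r : ℕ} (hr : r < G) :
    Computes O G (.ask i r) v 1 (Function.update v r (O i (v r))) :=
  fun t ht => ⟨_, _, _, .ask t i r, le_rfl, agree_update ht (by rw [ht r hr])⟩

theorem seq (h₁ : Computes O G P v T₁ v₁) (h₂ : Computes O G Q v₁ T₂ v₂) :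
    Computes O G (.seq P Q) v (T₁ + T₂) v₂ := by
  intro t ht
  obtain ⟨c₁, l₁, t₁, e₁, hc₁, ht₁⟩ := h₁ t ht
  obtain ⟨c₂, l₂, t₂, e₂, hc₂, ht₂⟩ := h₂ t₁ ht₁
  exact ⟨_, _, t₂, e₁.seq e₂, by omega, ht₂⟩

theorem cond_true {r : ℕ} (hr : r < G) (hv : (v r).head? = some true)
    (h : Computes O G P v T v₁) : Computes O G (.cond r P Q R) v (1 + T) v₁ := by
  intro t ht
  obtain ⟨c, l, t', e, hc, ht'⟩ := h t ht
  exact ⟨_, _, t', .cond_true (by rw [ht r hr, hv]) e, by omega, ht'⟩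

theorem cond_false {r : ℕ} (hr : r < G) (hv : (v r).head? = some false)
    (h : Computes O G Q v T v₁) : Computes O G (.cond r P Q R) v (1 + T) v₁ := by
  intro t ht
  obtain ⟨c, l, t', e, hc, ht'⟩ := h t ht
  exact ⟨_, _, t', .cond_false (by rw [ht r hr, hv]) e, by omega, ht'⟩

theorem cond_empty {r : ℕ} (hr : r < G) (hv : v r = [])
    (h : Computes O G R v T v₁) : Computes O G (.cond r P Q R) v (1 + T) v₁ := by
  intro t ht
  obtain ⟨c, l, t', e, hc, ht'⟩ := h t ht
  exact ⟨_, _, t', .cond_empty (by rw [ht r hr, hv]) e, by omega, ht'⟩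

theorem cond_nonempty {r : ℕ} (hr : r < G) (hv : v r ≠ [])
    (h : Computes O G P v T v₁) : Computes O G (.cond r P P R) v (1 + T) v₁ := by
  cases hx : v r with
  | nil => exact absurd hx hv
  | cons b l =>
    cases b
    · exact cond_false hr (by simp [hx]) h
    · exact cond_true hr (by simp [hx]) h

theorem loop_done {r : ℕ} (hr : r < G) (hv : v r = []) :
    Computes O G (.loop r P) v 1 v :=
  fun t ht => ⟨_, _, t, .loop_done (by rw [ht r hr, hv]), le_rfl, ht⟩

theorem loop_step {r : ℕ} (hr : r < G) (hv : v r ≠ []) (h₁ : Computes O G P v T₁ v₁)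
    (h₂ : Computes O G (.loop r P) v₁ T₂ v₂) :
    Computes O G (.loop r P) v (1 + T₁ + T₂) v₂ := by
  intro t ht
  obtain ⟨c₁, l₁, t₁, e₁, hc₁, ht₁⟩ := h₁ t ht
  obtain ⟨c₂, l₂, t₂, e₂, hc₂, ht₂⟩ := h₂ t₁ ht₁
  exact ⟨_, _, t₂, .loop_step (by rwa [ht r hr]) e₁ e₂, by omega, ht₂⟩

end Computes

/-- The store `v` on the registers below `b`, followed by the store `s`. -/
def Store.append (b : ℕ) (v s : Store) : Store := fun i => if i < b then v i else s (i - b)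

theorem Store.append_add (b : ℕ) (v s : Store) (r : ℕ) : Store.append b v s (b + r) = s r := by
  simp [Store.append]

theorem Store.append_of_lt {b : ℕ} (v s : Store) {r : ℕ} (hr : r < b) :
    Store.append b v s r = v r := by
  simp [Store.append, hr]

theorem Store.update_append_add (b : ℕ) (v s : Store) (r : ℕ) (x : List Bool) :
    Function.update (Store.append b v s) (b + r) x =
      Store.append b v (Function.update s r x) := by
  funext i
  simp only [Function.update_apply, Store.append]
  by_cases h : i < b
  · simp only [h, if_true]
    rw [if_neg (by omega)]
  · simp only [h, if_false]
    exact if_congr (by omega) rfl rfl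

theorem Store.update_append_of_lt {b : ℕ} (v s : Store) {r : ℕ} (hr : r < b) (x : List Bool) :
    Function.update (Store.append b v s) r x =
      Store.append b (Function.update v r x) s := by
  funext i
  simp only [Function.update_apply, Store.append]
  by_cases h : i < b
  · simp only [h, if_true]
  · simp only [h, if_false]
    rw [if_neg (by omega)]

/-- If the programs `S i` implement the oracles `O i`, where the registers `base l` below `b` may
depend on the list `l` of the previous queries, then `P.compile b S` simulates `P`. -/
theorem Exec.compile {O : ι → List Bool → List Bool} {O' : κ → List Bool → List Bool}
    {P : Prog ι} {s s' : Store} {c : ℕ} {l : List (ι × List Bool)} (h : Exec O P s c l s')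
    {b K M T : ℕ} {S : ι → ℕ → Prog κ} {base : List (ι × List Bool) → Store} (hT : 1 ≤ T)
    (hS : ∀ i r l s, r < K → (s r).length ≤ M →
      Computes O' (b + K) (S i (b + r)) (Store.append b (base l) s) T
        (Store.append b (base (l ++ [(i, s r)])) (Function.update s r (O i (s r))))) :
    ∀ {M₀ : ℕ} (l₀ : List (ι × List Bool)), P.width ≤ K → (∀ i x, (O i x).length ≤ M₀) →
      (∀ r, (s r).length ≤ M₀) → M₀ + c ≤ M →
      Computes O' (b + K) (P.compile b S) (Store.append b (base l₀) s) (c * T)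
        (Store.append b (base (l₀ ++ l)) s') := by
  -- Instructions other than oracle calls are not slowed down; this charges them the factor `T` as
  -- well.
  have key : ∀ {c}, c ≤ c * T := Nat.le_mul_of_pos_right _ hT
  induction h with
  | skip s =>
    intro M₀ l₀ _ _ _ _
    simpa [Prog.compile] using (Computes.skip _).mono_cost key
  | push s r x =>
    intro M₀ l₀ hw _ _ _
    simp only [Prog.width] at hw
    have := Computes.push (O := O') (G := b + K) (Store.append b (base l₀) s) (r := b + r)
      (by omega) x
    rw [Store.append_add, Store.update_append_add] at this
    simpa [Prog.compile] using this.mono_cost key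
  | pop s r =>
    intro M₀ l₀ hw _ _ _
    simp only [Prog.width] at hw
    have := Computes.pop (O := O') (G := b + K) (Store.append b (base l₀) s) (r := b + r)
      (by omega)
    rw [Store.append_add, Store.update_append_add] at this
    simpa [Prog.compile] using this.mono_cost key
  | copy s d r =>
    intro M₀ l₀ hw _ _ _
    simp only [Prog.width] at hw
    have := Computes.copy (O := O') (G := b + K) (Store.append b (base l₀) s) (b + d)
      (r := b + r) (by omega)
    rw [Store.append_add, Store.update_append_add] at this
    simpa [Prog.compile] using this.mono_cost key
  | ask s i r =>
    intro M₀ l₀ hw _ hs hM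
    simp only [Prog.width] at hw
    simpa [Prog.compile] using hS i r l₀ s (by omega) ((hs r).trans (by omega))
  | @seq _ _ _ _ _ _ _ l₁ _ e₁ _ ih₁ ih₂ =>
    intro M₀ l₀ hw hO hs hM
    simp only [Prog.width] at hw
    have h₁ := ih₁ l₀ (by omega) hO hs (by omega)
    -- The second program starts with a longer log and with registers that may have grown by the
    -- cost of the first.
    have h₂ := ih₂ (l₀ ++ l₁) (by omega) (fun i x => (hO i x).trans (Nat.le_add_right _ _))
      (e₁.length_le hO hs) (by omega)
    rw [List.append_assoc] at h₂
    simpa only [add_mul, Prog.compile] using h₁.seq h₂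
  | cond_true hx _ ih =>
    intro M₀ l₀ hw hO hs hM
    simp only [Prog.width] at hw
    refine ((ih l₀ (by omega) hO hs (by omega)).cond_true (by omega)
      (by rw [Store.append_add, hx])).mono_cost ?_
    rw [add_mul]; omega
  | cond_false hx _ ih =>
    intro M₀ l₀ hw hO hs hM
    simp only [Prog.width] at hw
    refine ((ih l₀ (by omega) hO hs (by omega)).cond_false (by omega)
      (by rw [Store.append_add, hx])).mono_cost ?_
    rw [add_mul]; omega
  | cond_empty hx _ ih =>
    intro M₀ l₀ hw hO hs hM
    simp only [Prog.width] at hw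
    refine ((ih l₀ (by omega) hO hs (by omega)).cond_empty (by omega)
      (by rw [Store.append_add, hx])).mono_cost ?_
    rw [add_mul]; omega
  | loop_done hx =>
    intro M₀ l₀ hw _ _ _
    simp only [Prog.width] at hw
    simpa [Prog.compile] using (Computes.loop_done (by omega) (by rw [Store.append_add, hx])).mono_cost key
  | @loop_step _ _ _ _ _ _ _ l₁ _ hx e₁ _ ih₁ ih₂ =>
    intro M₀ l₀ hw hO hs hM
    have hw' := hw
    simp only [Prog.width] at hw
    have h₁ := ih₁ l₀ (by omega) hO hs (by omega)
    have h₂ := ih₂ (l₀ ++ l₁) hw' (fun i x => (hO i x).trans (Nat.le_add_right _ _))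
      (e₁.length_le hO hs) (by omega)
    rw [List.append_assoc] at h₂
    refine (h₁.loop_step (by omega) (by rwa [Store.append_add]) h₂).mono_cost ?_
    simp only [add_mul]; omega

end Relocation

/-! ## Subroutine calls -/

section Call

variable {ι : Type}

/-- Empty the registers `d, …, d + k - 1` with the help of the empty register `z`. -/
def Prog.clear (z d : ℕ) : ℕ → Prog ι
  | 0 => .skip
  | k + 1 => .seq (clear z d k) (.copy (d + k) z)

/-- Each copy of the empty register costs a single step, so the cost does not depend on what is
erased. This matters because `Computes` allows arbitrary contents in the working space. -/
theorem Computes.clear {O : ι → List Bool → List Bool} {N z d : ℕ} (v : Store) (hz : v z = [])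
    (hzd : z < d) (hd : d ≤ N) (k : ℕ) :
    Computes O N (Prog.clear z d k) v (k + 1)
      (fun i => if d ≤ i ∧ i < d + k then [] else v i) := by
  induction k with
  | zero => exact (Computes.skip v).mono le_rfl fun i _ => (if_neg (by omega)).symm
  | succ k ih =>
    refine (ih.seq (Computes.copy _ (d + k) (r := z) (by omega))).mono ?_ fun i _ => ?_
    · rw [if_neg (by omega), hz]
      simp
    · simp only [Function.update_apply]
      rw [if_neg (show ¬(d ≤ z ∧ z < d + k) by omega), hz]
      split_ifs <;> first | rfl | omega

/-- Copy the registers `rs` to the registers `d, d + 1, …`. -/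
def Prog.load : ℕ → List ℕ → Prog ι
  | _, [] => .skip
  | d, r :: rs => .seq (.copy d r) (load (d + 1) rs)

theorem Computes.load {O : ι → List Bool → List Bool} {N : ℕ} (rs : List ℕ) :
    ∀ (v : Store) {d : ℕ}, d + rs.length ≤ N → (∀ r ∈ rs, r < d) →
    Computes O N (Prog.load d rs) v (1 + rs.length + ((rs.map v).map List.length).sum)
      (fun i => if d ≤ i ∧ i < d + rs.length then (rs.map v).getD (i - d) [] else v i) := by
  induction rs with
  | nil =>
    intro v d _ _
    exact (Computes.skip v).mono (by simp) fun i _ => (if_neg (by simp)).symm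
  | cons r rs ih =>
    intro v d hd hr
    rw [List.length_cons] at hd
    have hr₀ : r < d := hr r (by simp)
    have hmap : rs.map (Function.update v d (v r)) = rs.map v :=
      List.map_congr_left fun x hx =>
        Function.update_of_ne (hr x (by simp [hx])).ne _ _
    have h := ih (Function.update v d (v r)) (d := d + 1) (by omega) fun x hx =>
      (hr x (by simp [hx])).trans (Nat.lt_succ_self d)
    rw [hmap] at h
    refine ((Computes.copy v d (r := r) (by omega)).seq h).mono ?_ fun i _ => ?_
    · simp only [List.length_cons, List.map_cons, List.sum_cons]
      omega
    · simp only [List.length_cons, List.map_cons]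
      rcases lt_trichotomy i d with hi | rfl | hi
      · rw [if_neg (by omega), if_neg (by omega), Function.update_of_ne hi.ne]
      · rw [if_neg (by omega), if_pos (by omega)]
        simp
      · obtain ⟨j, rfl⟩ : ∃ j, i = d + 1 + j := ⟨i - (d + 1), by omega⟩
        have h₁ : d + 1 + j - (d + 1) = j := by omega
        have h₂ : d + 1 + j - d = j + 1 := by omega
        rw [h₁, h₂, List.getD_cons_succ]
        exact if_congr (by omega) rfl (Function.update_of_ne (by omega) _ _)

/-- Run `P` on the contents of the registers `rs` and store its output in `dst`. The registers
from `G` on are its working space; the register `z` must be empty. -/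
def Prog.call (P : Prog Empty) (G z : ℕ) (rs : List ℕ) (dst : ℕ) : Prog ι :=
  .seq (.clear z G (P.width + rs.length + 1))
    (.seq (.load G rs) (.seq (P.compile G fun i _ => i.elim) (.copy dst G)))

/-- The cost of a subroutine call, where `w` is the width of the program, `k` the number of
inputs, `a` their total length and `T` the running time. -/
def callCost (w k a T : ℕ) : ℕ := w + 2 * k + 2 * a + 2 * T + 4

/-- The working space lies above `G`, where `Computes` makes no claim, so leftovers of earlier calls
are harmless: they are erased before the inputs are loaded. -/
theorem Computes.call {O : ι → List Bool → List Bool} {G z dst : ℕ} {P : Prog Empty}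
    {rs : List ℕ} (v : Store) {out : List Bool} {T : ℕ}
    (h : P.OutputsIn (rs.map v) out T) (hz : v z = []) (hzG : z < G) (hrs : ∀ r ∈ rs, r < G) :
    Computes O G (P.call G z rs dst) v
      (callCost P.width rs.length ((rs.map v).map List.length).sum T)
      (Function.update v dst out) := by
  have hlen := h.length_le
  obtain ⟨c, l, ⟨s', he, rfl⟩, hc⟩ := h
  -- Enough registers for the program and for its inputs; the extra one ensures that the output
  -- register `G` is among them.
  set k := P.width + rs.length + 1 with hk
  intro t ht
  have hmap : rs.map t = rs.map v := List.map_congr_left fun r hr => ht r (hrs r hr)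
  have h₁ := Computes.clear (O := O) (N := G + k) t ((ht z hzG).trans hz) hzG (by omega) k
  have h₂ := Computes.load (O := O) (N := G + k) rs
    (fun i => if G ≤ i ∧ i < G + k then [] else t i) (d := G) (by omega) hrs
  have hmap' : rs.map (fun i => if G ≤ i ∧ i < G + k then [] else t i) = rs.map v := by
    rw [← hmap]
    refine List.map_congr_left fun r hr => if_neg ?_
    have := hrs r hr
    omega
  rw [hmap'] at h₂
  -- Without oracles there is nothing to substitute: relocation costs no factor and leaves the lower
  -- registers alone.
  have h₃ := he.compile (O' := O) (b := G) (K := k) (T := 1) (S := fun i _ => i.elim)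
    (base := fun _ => v) le_rfl (fun i => i.elim) [] (by omega)
    (M₀ := ((rs.map v).map List.length).sum) (fun i => i.elim)
    (List.length_getD_le_sum _) le_rfl
  have h₄ := Computes.copy (O := O) (G := G + k) (Store.append G v s') dst (r := G) (by omega)
  have h₅ := h₁.seq (h₂.seq ((h₃.seq h₄).congr_left fun i hi => ?_))
  · obtain ⟨c', l', t', he', hc', ht'⟩ := h₅ t fun _ _ => rfl
    refine ⟨c', l', t', he', hc'.trans ?_, fun i hi => ?_⟩
    · have : Store.append G v s' G = s' 0 := Store.append_add G v s' 0
      rw [this]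
      unfold callCost
      omega
    · rw [ht' i (by omega), Function.update_apply, Function.update_apply,
        Store.append_of_lt _ _ hi]
      exact if_congr Iff.rfl (Store.append_add G v s' 0) rfl
  · by_cases h : i < G
    · rw [Store.append_of_lt _ _ h, if_neg (by omega), if_neg (by omega), ht i h]
    · obtain ⟨j, rfl⟩ : ∃ j, i = G + j := ⟨i - G, by omega⟩
      rw [Store.append_add, Nat.add_sub_cancel_left]
      split_ifs with h₁
      · rfl
      · rw [List.getD_eq_default _ _ (by rw [List.length_map]; omega)]
      all_goals omega

end Call

/-! ## Moving, mapping, decoding and searching -/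

section Macros

variable {ι : Type} {O : ι → List Bool → List Bool} {G : ℕ}

/-- Move the top bit of `a` to `b`. -/
def Prog.moveBit (a b : ℕ) : Prog ι :=
  .cond a (.seq (.pop a) (.push b true)) (.seq (.pop a) (.push b false)) .skip

theorem Computes.moveBit (v : Store) {a b : ℕ} (hab : a ≠ b) (ha : a < G) (hb : b < G)
    {x : Bool} {u : List Bool} (hv : v a = x :: u) :
    Computes O G (.moveBit a b) v 3
      (Function.update (Function.update v a u) b (x :: v b)) := by
  have h (y : Bool) := (Computes.pop (O := O) v ha).seq (Computes.push _ hb y)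
  simp only [hv, List.tail_cons, Function.update_of_ne hab.symm] at h
  cases x
  · exact (h false).cond_false ha (by simp [hv])
  · exact (h true).cond_true ha (by simp [hv])

/-- Move the content of `a` to `b`, in reverse order. -/
def Prog.moveRev (a b : ℕ) : Prog ι := .loop a (.moveBit a b)

theorem Computes.moveRev (v : Store) {a b : ℕ} (hab : a ≠ b) (ha : a < G) (hb : b < G)
    {u : List Bool} (hv : v a = u) :
    Computes O G (.moveRev a b) v (4 * u.length + 1)
      (Function.update (Function.update v a []) b (u.reverse ++ v b)) := by
  induction u generalizing v with
  | nil =>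
    refine (Computes.loop_done ha hv).congr_right ?_
    funext i
    grind [Function.update_apply]
  | cons x u ih =>
    refine (Computes.loop_step ha (by simp [hv]) (Computes.moveBit v hab ha hb hv)
      (ih _ ?_)).mono ?_ fun i _ => ?_
    · rw [Function.update_of_ne hab, Function.update_self]
    · simp only [List.length_cons]; omega
    · grind [Function.update_apply]

/-- Move as many bits from `a` to `b`, in reverse order, as there are in `u`. -/
def Prog.takeRev (u a b : ℕ) : Prog ι := .loop u (.seq (.pop u) (.moveBit a b))

theorem Computes.takeRev (v : Store) {u a b : ℕ} (hua : u ≠ a) (hub : u ≠ b) (hab : a ≠ b)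
    (hu : u < G) (ha : a < G) (hb : b < G) {w p q : List Bool} (hw : v u = w)
    (hv : v a = p ++ q) (hl : p.length = w.length) :
    Computes O G (.takeRev u a b) v (5 * w.length + 1)
      (Function.update (Function.update (Function.update v u []) a q) b
        (p.reverse ++ v b)) := by
  induction w generalizing v p with
  | nil =>
    obtain rfl := List.length_eq_zero_iff.mp hl
    refine (Computes.loop_done hu hw).mono le_rfl fun i _ => ?_
    grind [Function.update_apply]
  | cons y w ih =>
    cases p with
    | nil => simp at hl
    | cons x p =>
      have h₁ := (Computes.pop (O := O) v hu).seq
        (Computes.moveBit (x := x) (u := p ++ q) _ hab ha hb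
          (by rw [Function.update_of_ne hua.symm, hv]; rfl))
      refine (Computes.loop_step hu (by simp [hw]) h₁ (ih _ (p := p) ?_ ?_ ?_)).mono ?_
        fun i _ => ?_
      · simp only [Function.update_apply]
        simp [hua, hub, hw]
      · simp only [Function.update_apply]
        simp [hab]
      · simpa using hl
      · simp only [List.length_cons]; omega
      · grind [Function.update_apply]

/-- Move the content of `a` to the top of `b`, in the same order, with the help of `c`. -/
def Prog.prepend (a c b : ℕ) : Prog ι := .seq (.moveRev a c) (.moveRev c b)

theorem Computes.prepend (v : Store) {a b c : ℕ} (hab : a ≠ b) (hac : a ≠ c) (hcb : c ≠ b)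
    (ha : a < G) (hb : b < G) (hc : c < G) (hv : v c = []) :
    Computes O G (.prepend a c b) v (8 * (v a).length + 2)
      (Function.update (Function.update v a []) b (v a ++ v b)) := by
  have h₁ := Computes.moveRev (O := O) v hac ha hc rfl
  have h₂ := Computes.moveRev (O := O) _ hcb hc hb (Function.update_self c
    ((v a).reverse ++ v c) (Function.update v a []))
  refine (h₁.seq h₂).mono ?_ fun i _ => ?_
  · simp [hv]
    omega
  · simp only [Function.update_apply]
    split_ifs <;> simp_all

/-- Move a prefix of `r`, whose length is given in register `0`, to register `6`. -/
def Prog.splitKey (r : ℕ) : Prog ι :=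
  .seq (.copy 10 0) (.seq (.takeRev 10 r 11) (.moveRev 11 6))

/-- A copy of `1^lam` serves as the counter, and passing through register `11` reverses the bits
twice. -/
theorem Computes.splitKey (hG : 12 ≤ G) (v : Store) {r lam : ℕ} (hr : r < 6) {κ q : List Bool}
    (h0 : v 0 = unary lam) (h6 : v 6 = []) (h10 : v 10 = []) (h11 : v 11 = [])
    (hv : v r = κ ++ q) (hκ : κ.length = lam) :
    Computes O G (.splitKey r) v (10 * lam + 3)
      (Function.update (Function.update v r q) 6 κ) := by
  have hl : (v 0).length = lam := by rw [h0]; exact List.length_replicate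
  have e1 := Computes.copy (O := O) (G := G) v 10 (r := 0) (by omega)
  have e2 := Computes.takeRev (O := O) (G := G) (Function.update v 10 (v 0)) (u := 10)
    (a := r) (b := 11) (by omega) (by omega) (by omega) (by omega) (by omega) (by omega)
    (w := v 0) (p := κ) (q := q) (Function.update_self _ _ _)
    (by rw [Function.update_of_ne (by omega), hv]) (by omega)
  have e3 := Computes.moveRev (O := O) (G := G) _ (a := 11) (b := 6) (by omega) (by omega)
    (by omega) (Function.update_self 11 (κ.reverse ++ Function.update v 10 (v 0) 11)
      (Function.update (Function.update (Function.update v 10 (v 0)) 10 []) r q))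
  refine (e1.seq (e2.seq e3)).mono ?_ fun i _ => ?_
  · simp [h11, hl, hκ]
    omega
  · clear e1 e2 e3
    simp only [Function.update_apply]
    split_ifs <;> simp_all

/-- Apply the program `R`, which acts on register `12`, to all keys in register `2`; their length
is given in register `0`. The results are accumulated in register `13`, in reverse order. -/
def Prog.mapKeys (R : Prog ι) : Prog ι :=
  .loop 2 (.seq (.copy 10 0) (.seq (.takeRev 10 2 11) (.seq (.moveRev 11 12)
    (.seq R (.moveRev 12 13)))))

/-- The hypothesis on `R` is needed only for stores that differ from the initial one in the
registers `2`, `12` and `13`, since these are all that changes between iterations. `R` may therefore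
rely on parameters kept elsewhere, such as a key. -/
theorem Computes.mapKeys {R : Prog ι} {lam T : ℕ} {f : List Bool → List Bool}
    (hG : 14 ≤ G) (hf : ∀ x, (f x).length = x.length) (keys : List (List Bool)) :
    ∀ (v : Store), (∀ w : Store, (∀ i, i ≠ 2 → i ≠ 12 → i ≠ 13 → w i = v i) →
      (w 12).length = lam → Computes O G R w T (Function.update w 12 (f (w 12)))) →
    (∀ x ∈ keys, x.length = lam) → (v 0).length = lam → v 2 = keys.flatten →
    v 10 = [] → v 11 = [] → v 12 = [] →
    Computes O G (.mapKeys R) v (keys.length * (14 * lam + T + 5) + 1)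
      (Function.update (Function.update v 2 []) 13 ((keys.map f).flatten.reverse ++ v 13)) := by
  induction keys with
  | nil =>
    intro v _ _ _ h2 _ _ _
    refine (Computes.loop_done (by omega) h2).mono (by simp) fun i _ => ?_
    simp only [Function.update_apply]
    split_ifs <;> simp_all
  | cons x keys ih =>
    intro v hR hlen h0 h2 h10 h11 h12
    have hx : x.length = lam := hlen x (by simp)
    -- Keys of length zero leave no trace in the concatenation: the loop stops at once, which is
    -- correct because all images are empty too.
    rcases Nat.eq_zero_or_pos lam with rfl | hlam
    · obtain rfl := List.length_eq_zero_iff.mp hx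
      have hkeys : ∀ y ∈ keys, y = [] := fun y hy =>
        List.length_eq_zero_iff.mp (hlen y (by simp [hy]))
      have hfx : ∀ y : List Bool, y = [] → f y = [] := fun y hy =>
        List.length_eq_zero_iff.mp (by rw [hf, hy]; rfl)
      have hflat : keys.flatten = [] := by simpa using hkeys
      have hflat' : (keys.map f).flatten = [] := by
        simpa using fun y hy => hfx y (hkeys y hy)
      have h2' : v 2 = [] := by simp [h2, hflat]
      refine (Computes.loop_done (by omega) h2').mono (by omega) fun i _ => ?_
      simp only [Function.update_apply, List.map_cons, List.flatten_cons, hflat', hfx [] rfl]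
      split_ifs <;> simp_all
    · have e1 := Computes.copy (O := O) (G := G) v 10 (r := 0) (by omega)
      have e2 := Computes.takeRev (O := O) (G := G) (Function.update v 10 (v 0)) (u := 10)
        (a := 2) (b := 11) (by decide) (by decide) (by decide) (by omega) (by omega) (by omega)
        (w := v 0) (p := x) (q := keys.flatten) (by simp) (by simp [h2]) (by omega)
      have e3 := (Computes.moveRev (O := O) (G := G) (Function.update (Function.update
        (Function.update (Function.update v 10 (v 0)) 10 []) 2 keys.flatten) 11
        (x.reverse ++ Function.update v 10 (v 0) 11)) (a := 11) (b := 12) (by decide) (by omega)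
        (by omega) (u := x.reverse) (by simp [h11])).congr_right
        (v₂ := Function.update (Function.update v 2 keys.flatten) 12 x) (by
          clear ih hR hlen e1 e2 hf h2
          funext i
          grind [Function.update_apply])
      have e4 := hR (Function.update (Function.update v 2 keys.flatten) 12 x)
        (fun i hi hi' _ => by simp [hi, hi']) (by simpa using hx)
      have e5 := (Computes.moveRev (O := O) (G := G) (Function.update (Function.update
        (Function.update v 2 keys.flatten) 12 x) 12 (f x)) (a := 12) (b := 13) (by decide)
        (by omega) (by omega) (u := f x) (by simp)).congr_right
        (v₂ := Function.update (Function.update v 2 keys.flatten) 13 ((f x).reverse ++ v 13)) (by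
          clear ih hR hlen e1 e2 e3 e4 hf h2
          funext i
          grind [Function.update_apply])
      simp only [Function.update_self] at e4
      have e6 := ih (Function.update (Function.update v 2 keys.flatten) 13
        ((f x).reverse ++ v 13))
        (fun w hw hl => hR w (fun i hi hi' hi'' => by simp [hw i hi hi' hi'', hi, hi'']) hl)
        (fun y hy => hlen y (by simp [hy])) (by simpa using h0) (by simp) (by simpa using h10)
        (by simpa using h11) (by simpa using h12)
      have h2' : v 2 ≠ [] := by
        rw [h2]
        intro h
        obtain rfl : x = [] := by simp_all
        simp at hx
        omega
      refine (Computes.loop_step (by omega) h2'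
        (e1.seq (e2.seq (e3.seq (e4.seq e5)))) e6).mono ?_ fun i _ => ?_
      · simp only [List.length_cons, List.length_reverse, hf, hx, h0, add_mul]
        linarith
      · grind [Function.update_apply]

/-! ### Packing several strings into one -/

/-- The bits of `w`, each preceded by the tag `1^j 0`. -/
def tagged (j : ℕ) (w : List Bool) : List Bool :=
  w.flatMap fun b => List.replicate j true ++ [false, b]

theorem length_tagged (j : ℕ) (w : List Bool) : (tagged j w).length = w.length * (j + 2) := by
  simp [tagged, List.length_flatMap]

/-- Move the tagged bit on top of `a` to the register in `rs` selected by its tag. -/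
def Prog.readTagged (a : ℕ) : List ℕ → Prog ι
  | [] => .skip
  | r :: rs => .cond a (.seq (.pop a) (readTagged a rs)) (.seq (.pop a) (.moveBit a r)) .skip

theorem Computes.readTagged {a r : ℕ} (har : a ≠ r) (ha : a < G) (hr : r < G) {b : Bool}
    {rest : List Bool} (rs : List ℕ) : ∀ (v : Store) {j : ℕ}, rs[j]? = some r →
    v a = List.replicate j true ++ false :: b :: rest →
    Computes O G (.readTagged a rs) v (2 * j + 5)
      (Function.update (Function.update v a rest) r (b :: v r)) := by
  induction rs with
  | nil => intro v j hj; simp at hj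
  | cons r' rs ih =>
    intro v j hj hv
    cases j with
    | zero =>
      obtain rfl : r' = r := by simpa using hj
      have h := (Computes.pop (O := O) v ha).seq
        (Computes.moveBit (x := b) (u := rest) _ har ha hr (by simp [hv]))
      refine (h.cond_false ha (by simp [hv])).mono (by omega) fun i _ => ?_
      grind [Function.update_apply]
    | succ j =>
      have h := (Computes.pop (O := O) v ha).seq
        (ih (Function.update v a (v a).tail) (j := j) (by simpa using hj)
          (by simp [hv, List.replicate_succ]))
      refine (h.cond_true ha (by simp [hv, List.replicate_succ])).mono (by omega) fun i _ => ?_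
      grind [Function.update_apply]

/-- Stated with a continuation: what the loop does after the block with tag `j` is a hypothesis.
Blocks with different tags are thus handled by chaining instances for one and the same loop. -/
theorem Computes.loop_readTagged {a r j T : ℕ} (har : a ≠ r) (ha : a < G) (hr : r < G)
    {rs : List ℕ} (hj : rs[j]? = some r) {rest : List Bool} {v' : Store} (w : List Bool) :
    ∀ v : Store, v a = tagged j w ++ rest →
    Computes O G (.loop a (.readTagged a rs))
      (Function.update (Function.update v a rest) r (w.reverse ++ v r)) T v' →
    Computes O G (.loop a (.readTagged a rs)) v (w.length * (2 * j + 6) + T) v' := by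
  induction w with
  | nil =>
    intro v hv h
    refine (h.congr_left fun i _ => ?_).mono_cost (by simp)
    simp only [Function.update_apply]
    split_ifs <;> simp_all [tagged]
  | cons b w ih =>
    intro v hv h
    have hv' : v a = List.replicate j true ++ false :: b :: (tagged j w ++ rest) := by
      simp [hv, tagged]
    refine (Computes.loop_step ha (by simp [hv'])
      (Computes.readTagged har ha hr rs v hj hv') (ih _ (by simp [har])
        (h.congr_left fun i _ => ?_))).mono_cost ?_
    · grind [Function.update_apply]
    · simp only [List.length_cons, add_mul]
      omega

/-! ### Searching a list of keys -/

/-- Compare the top bits of registers `11` and `15` and remove them; empty register `10` if they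
differ. -/
def Prog.matchBit : Prog ι :=
  .seq (.cond 11 (.cond 15 .skip (.copy 10 14) (.copy 10 14))
    (.cond 15 (.copy 10 14) .skip (.copy 10 14)) .skip) (.seq (.pop 11) (.pop 15))

/-- Register `10` is a flag that stays nonempty as long as no mismatch was seen; copying the empty
register `14` lowers it. -/
theorem Computes.matchBit (v : Store) (hG : 16 ≤ G) {b b' : Bool} {u u' : List Bool}
    (h11 : v 11 = b :: u) (h15 : v 15 = b' :: u') (h14 : v 14 = []) :
    Computes O G .matchBit v 5
      (Function.update (Function.update (Function.update v 11 u) 15 u') 10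
        (if b = b' then v 10 else [])) := by
  have e : Computes O G (.seq (.pop 11) (.pop 15))
      (Function.update v 10 (if b = b' then v 10 else [])) 2
      (Function.update (Function.update (Function.update v 11 u) 15 u') 10
        (if b = b' then v 10 else [])) := by
    refine ((Computes.pop _ (by omega)).seq (Computes.pop _ (by omega))).mono le_rfl
      fun i _ => ?_
    grind [Function.update_apply]
  have hs : Computes O G .skip v 1 (Function.update v 10 (v 10)) := by
    rw [Function.update_eq_self]
    exact Computes.skip v
  have hc : Computes O G (.copy 10 14) v 1 (Function.update v 10 []) := by
    simpa [h14] using Computes.copy (O := O) (G := G) v 10 (r := 14) (by omega)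
  have e' : Computes O G (.cond 11 (.cond 15 .skip (.copy 10 14) (.copy 10 14))
      (.cond 15 (.copy 10 14) .skip (.copy 10 14)) .skip) v 3
      (Function.update v 10 (if b = b' then v 10 else [])) := by
    cases b <;> cases b'
    · exact (hs.cond_false (r := 15) (by omega) (by simp [h15])).cond_false (by omega)
        (by simp [h11])
    · exact (hc.cond_true (r := 15) (by omega) (by simp [h15])).cond_false (by omega)
        (by simp [h11])
    · exact (hc.cond_false (r := 15) (by omega) (by simp [h15])).cond_true (by omega)
        (by simp [h11])
    · exact (hs.cond_true (r := 15) (by omega) (by simp [h15])).cond_true (by omega)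
        (by simp [h11])
  exact e'.seq e

theorem Computes.loop_matchBit (hG : 16 ≤ G) {rest : List Bool} (u : List Bool) :
    ∀ (v : Store) (w : List Bool), w.length = u.length → v 11 = u → v 15 = w ++ rest →
    v 14 = [] →
    Computes O G (.loop 11 .matchBit) v (6 * u.length + 1)
      (Function.update (Function.update (Function.update v 11 []) 15 rest) 10
        (if u = w then v 10 else [])) := by
  induction u with
  | nil =>
    intro v w hl h11 h15 _
    obtain rfl := List.length_eq_zero_iff.mp hl
    refine (Computes.loop_done (by omega) h11).mono le_rfl fun i _ => ?_
    grind [Function.update_apply]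
  | cons b u ih =>
    intro v w hl h11 h15 h14
    cases w with
    | nil => simp at hl
    | cons b' w =>
      refine (Computes.loop_step (by omega) (by simp [h11])
        (Computes.matchBit v hG h11 (u' := w ++ rest) h15 h14)
        (ih _ w (by simpa using hl) (by simp) (by simp) (by simpa using h14))).mono ?_
        fun i _ => ?_
      · simp only [List.length_cons]; omega
      · grind [Function.update_apply]

/-- Empty register `12` if the string in register `16` is one of the keys in register `15`. -/
def Prog.rejectMember : Prog ι :=
  .loop 15 (.seq (.copy 11 16) (.seq (.push 10 true) (.seq (.loop 11 .matchBit)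
    (.cond 10 (.seq (.copy 12 14) (.pop 10)) .skip .skip))))

/-- Comparing consumes exactly one key of register `15`, whatever the outcome, so the next key is
aligned. Positivity of `lam` makes a nonempty list of keys visible as a nonempty register. -/
theorem Computes.rejectMember (hG : 17 ≤ G) {lam : ℕ} (hlam : 0 < lam) {k : List Bool}
    (hk : k.length = lam) (keys : List (List Bool)) :
    ∀ v : Store, (∀ x ∈ keys, x.length = lam) → v 15 = keys.flatten → v 16 = k →
    v 10 = [] → v 11 = [] → v 14 = [] →
    Computes O G .rejectMember v (keys.length * (7 * lam + 9) + 1)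
      (Function.update (Function.update v 15 []) 12 (if k ∈ keys then [] else v 12)) := by
  induction keys with
  | nil =>
    intro v _ h15 _ _ _ _
    refine (Computes.loop_done (by omega) h15).mono (by simp) fun i _ => ?_
    grind [Function.update_apply]
  | cons x keys ih =>
    intro v hlen h15 h16 h10 h11 h14
    have hx : x.length = lam := hlen x (by simp)
    have e1 := Computes.copy (O := O) (G := G) v 11 (r := 16) (by omega)
    have e2 := Computes.push (O := O) (G := G) (Function.update v 11 (v 16)) (r := 10)
      (by omega) true
    have e3 := (Computes.loop_matchBit (O := O) (G := G) (by omega) (rest := keys.flatten) k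
      (Function.update (Function.update v 11 (v 16)) 10
        (true :: Function.update v 11 (v 16) 10)) x (by omega) (by simp [h16])
        (by simp [h15]) (by simp [h14])).congr_right
      (v₂ := Function.update (Function.update v 15 keys.flatten) 10
        (if k = x then [true] else [])) (by
          funext i
          grind [Function.update_apply])
    have e4 : Computes O G (.cond 10 (.seq (.copy 12 14) (.pop 10)) .skip .skip)
        (Function.update (Function.update v 15 keys.flatten) 10
          (if k = x then [true] else [])) 3
        (Function.update (Function.update v 15 keys.flatten) 12
          (if k = x then [] else v 12)) := by
      by_cases hkx : k = x
      · refine (((Computes.copy _ _ (by omega)).seq (Computes.pop _ (by omega))).cond_true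
          (by omega) (by simp [hkx])).mono (by simp [h14]) fun i _ => ?_
        grind [Function.update_apply]
      · refine ((Computes.skip _).cond_empty (by omega) (by simp [hkx])).mono (by omega)
          fun i _ => ?_
        grind [Function.update_apply]
    have e5 := ih (Function.update (Function.update v 15 keys.flatten) 12
      (if k = x then [] else v 12)) (fun y hy => hlen y (by simp [hy])) (by simp)
      (by simpa using h16) (by simpa using h10) (by simpa using h11) (by simpa using h14)
    have h15' : v 15 ≠ [] := by
      rw [h15]
      intro h
      obtain rfl : x = [] := by simp_all
      simp at hx
      omega
    refine (Computes.loop_step (by omega) h15' (e1.seq (e2.seq (e3.seq e4))) e5).mono ?_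
      fun i _ => ?_
    · simp only [List.length_cons, h16, hk, add_mul]
      linarith
    · grind [Function.update_apply]

end Macros

/-! ## Polynomial bounds -/

theorem Polynomial.monotone_eval_nat (p : Polynomial ℕ) : Monotone fun x : ℕ => p.eval x := by
  intro x y h
  simp only [Polynomial.eval_eq_sum]
  exact Finset.sum_le_sum fun i _ => Nat.mul_le_mul_left _ (Nat.pow_le_pow_left h _)

/-- `f` is given by a polynomial. -/
def IsPolynomial (f : ℕ → ℕ) : Prop := ∃ p : Polynomial ℕ, ∀ x, f x = p.eval x

namespace IsPolynomial

theorem id : IsPolynomial fun x => x := ⟨.X, by simp⟩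

theorem const (c : ℕ) : IsPolynomial fun _ => c := ⟨.C c, by simp⟩

theorem add {f g : ℕ → ℕ} : IsPolynomial f → IsPolynomial g → IsPolynomial fun x => f x + g x :=
  fun ⟨p, hp⟩ ⟨q, hq⟩ => ⟨p + q, by simp [hp, hq]⟩

theorem mul {f g : ℕ → ℕ} : IsPolynomial f → IsPolynomial g → IsPolynomial fun x => f x * g x :=
  fun ⟨p, hp⟩ ⟨q, hq⟩ => ⟨p * q, by simp [hp, hq]⟩

theorem eval (p : Polynomial ℕ) {f : ℕ → ℕ} :
    IsPolynomial f → IsPolynomial fun x => p.eval (f x) :=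
  fun ⟨q, hq⟩ => ⟨p.comp q, by simp [hq]⟩

end IsPolynomial

theorem callCost_mono {w k a a' T T' : ℕ} (ha : a ≤ a') (hT : T ≤ T') :
    callCost w k a T ≤ callCost w k a' T' := by
  unfold callCost
  omega

/-! ## The permuted filter -/

@[simp]
theorem length_unary (n : ℕ) : (unary n).length = n := List.length_replicate

/-- The keys in `L` as strings. -/
def keyStrings {lam : ℕ} (L : List (BitStr lam)) : List (List Bool) := L.map Subtype.val

theorem length_of_mem_keyStrings {lam : ℕ} {L : List (BitStr lam)} {x : List Bool}
    (hx : x ∈ keyStrings L) : x.length = lam := by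
  obtain ⟨y, _, rfl⟩ := List.mem_map.mp hx
  exact y.2

@[simp]
theorem length_keyStrings {lam : ℕ} (L : List (BitStr lam)) : (keyStrings L).length = L.length :=
  List.length_map _

theorem length_flatten_eq_mul {lam : ℕ} {xs : List (List Bool)} (h : ∀ x ∈ xs, x.length = lam) :
    xs.flatten.length = xs.length * lam := by
  induction xs with
  | nil => simp
  | cons x xs ih =>
    rw [List.flatten_cons, List.length_append, ih fun y hy => h y (by simp [hy]),
      h x (by simp), List.length_cons, add_mul, one_mul, add_comm]

theorem length_encodeKeys {lam : ℕ} (L : List (BitStr lam)) :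
    (encodeKeys L).length = L.length * lam := by
  rw [← length_keyStrings L]
  exact length_flatten_eq_mul fun x hx => length_of_mem_keyStrings hx

theorem encodeKeys_map_perm (F : KeyedPermutation) {lam : ℕ} (κ : List Bool)
    (L : List (BitStr lam)) :
    encodeKeys (L.map (F.perm lam κ)) = ((keyStrings L).map (F.toFun κ)).flatten := by
  exact congrArg List.flatten (List.map_map.trans
    (List.map_map (l := L) (f := Subtype.val) (g := F.toFun κ)).symm)

theorem Prog.OutputsIn.mono {P : Prog Empty} {xs : List (List Bool)} {out : List Bool} {T T' : ℕ}
    (h : P.OutputsIn xs out T) (hT : T ≤ T') : P.OutputsIn xs out T' := by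
  obtain ⟨c, l, h, hc⟩ := h
  exact ⟨c, l, h, hc.trans hT⟩

theorem Computes.outputsIn {P : Prog Empty} {G T : ℕ} {xs : List (List Bool)} {v' : Store}
    (h : Computes noOracle G P (fun i => xs.getD i []) T v') (hG : 0 < G) :
    P.OutputsIn xs (v' 0) T := by
  obtain ⟨c, l, t', he, hc, ht'⟩ := h _ fun _ _ => rfl
  exact ⟨c, l, ⟨t', he, ht' 0 hG⟩, hc⟩

namespace Prog

/-- The construction algorithm of the permuted filter. -/
def permutedConstruct (PF PC : Prog Empty) : Prog Empty :=
  .seq (.splitKey 3) (.seq (.mapKeys (.call PF 20 14 [6, 12] 12)) (.seq (.moveRev 13 8)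
    (.seq (.call PC 20 14 [0, 1, 8, 3] 0) (.prepend 6 9 0))))

/-- The query algorithm of the permuted filter. -/
def permutedQuery (PF PQ : Prog Empty) : Prog Empty :=
  .seq (.splitKey 2) (.seq (.call PF 20 14 [6, 3] 3) (.call PQ 20 14 [0, 1, 2, 3] 0))

theorem permutedQuery_outputsIn {PF PQ : Prog Empty} {lam TF TQ : ℕ}
    {κ params σ x y out : List Bool} (hκ : κ.length = lam) (hx : x.length = lam)
    (hF : PF.OutputsIn [κ, x] y TF) (hQ : PQ.OutputsIn [unary lam, params, σ, y] out TQ)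
    (hy : y.length = lam) :
    (permutedQuery PF PQ).OutputsIn [unary lam, params, κ ++ σ, x] out
      (10 * lam + 3 + callCost PF.width 2 (lam + lam) TF +
        callCost PQ.width 4 (lam + params.length + σ.length + lam) TQ) := by
  obtain ⟨v, hv⟩ : ∃ v : Store, v = fun i => [unary lam, params, κ ++ σ, x].getD i [] :=
    ⟨_, rfl⟩
  have v0 : v 0 = unary lam := by rw [hv]; rfl
  have v1 : v 1 = params := by rw [hv]; rfl
  have v3 : v 3 = x := by rw [hv]; rfl
  have v14 : v 14 = [] := by rw [hv]; rfl
  have e1 := Computes.splitKey (O := noOracle) (G := 20) (by omega) v (r := 2) (q := σ) (by omega)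
    v0 (by rw [hv]; rfl) (by rw [hv]; rfl) (by rw [hv]; rfl) (by rw [hv]; rfl) hκ
  have e2 := Computes.call (O := noOracle) (G := 20) (z := 14) (dst := 3) (P := PF) (rs := [6, 3])
    (Function.update (Function.update v 2 σ) 6 κ) (out := y) (T := TF)
    (by simpa [v3] using hF) (by simpa using v14) (by omega) (by simp)
  have e3 := Computes.call (O := noOracle) (G := 20) (z := 14) (dst := 0) (P := PQ)
    (rs := [0, 1, 2, 3]) (Function.update (Function.update (Function.update v 2 σ) 6 κ) 3 y)
    (out := out) (T := TQ)
    (by simpa [v0, v1] using hQ) (by simpa using v14) (by omega) (by simp)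
  have e := ((e1.seq (e2.seq e3)).congr_left
    (fun i _ => (congrFun hv i).symm)).outputsIn (by omega)
  rw [Function.update_self] at e
  refine e.mono ?_
  simp [v0, v1, v3, hκ, hx, hy, add_assoc]

theorem permutedConstruct_outputsIn {PF PC : Prog Empty} {lam TF TC : ℕ} {f : List Bool → List Bool}
    {κ params r out : List Bool} {keys : List (List Bool)} (hκ : κ.length = lam)
    (hkeys : ∀ x ∈ keys, x.length = lam) (hf : ∀ x, (f x).length = x.length)
    (hF : ∀ x, x.length = lam → PF.OutputsIn [κ, x] (f x) TF)
    (hC : PC.OutputsIn [unary lam, params, (keys.map f).flatten, r] out TC) :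
    (permutedConstruct PF PC).OutputsIn [unary lam, params, keys.flatten, κ ++ r] (κ ++ out)
      (18 * lam + 7 + keys.length * (14 * lam + callCost PF.width 2 (lam + lam) TF + 5) +
        4 * (keys.length * lam) +
        callCost PC.width 4 (lam + params.length + keys.length * lam + r.length) TC) := by
  obtain ⟨v, hv⟩ : ∃ v : Store,
    v = fun i => [unary lam, params, keys.flatten, κ ++ r].getD i [] := ⟨_, rfl⟩
  have v0 : v 0 = unary lam := by rw [hv]; rfl
  have v1 : v 1 = params := by rw [hv]; rfl
  have v2 : v 2 = keys.flatten := by rw [hv]; rfl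
  have v8 : v 8 = [] := by rw [hv]; rfl
  have v9 : v 9 = [] := by rw [hv]; rfl
  have v10 : v 10 = [] := by rw [hv]; rfl
  have v11 : v 11 = [] := by rw [hv]; rfl
  have v12 : v 12 = [] := by rw [hv]; rfl
  have v13 : v 13 = [] := by rw [hv]; rfl
  have v14 : v 14 = [] := by rw [hv]; rfl
  have hflat : (keys.map f).flatten.length = keys.length * lam := by
    rw [length_flatten_eq_mul (lam := lam), List.length_map]
    intro y hy
    obtain ⟨x, hx, rfl⟩ := List.mem_map.mp hy
    rw [hf, hkeys x hx]
  have e1 := Computes.splitKey (O := noOracle) (G := 20) (by omega) v (r := 3) (q := r) (by omega)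
    v0 (by rw [hv]; rfl) v10 v11 (by rw [hv]; rfl) hκ
  -- The key `κ` sits in register `6`, which the loop never touches, so each call finds it there.
  have e2 := Computes.mapKeys (O := noOracle) (G := 20) (lam := lam) (f := f)
    (R := .call PF 20 14 [6, 12] 12) (T := callCost PF.width 2 (lam + lam) TF) (by omega) hf keys
    (Function.update (Function.update v 3 r) 6 κ) (fun w hw hl => by
      have h6 : w 6 = κ := by simp [hw]
      have h := Computes.call (O := noOracle) (G := 20) (z := 14) (dst := 12) (P := PF)
        (rs := [6, 12]) w (out := f (w 12)) (T := TF) (by simpa [h6] using hF _ hl)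
        (by simp [hw, v14]) (by omega) (by simp)
      simpa [h6, hκ, hl] using h) hkeys (by simp [v0]) (by simp [v2]) (by simp [v10])
    (by simp [v11]) (by simp [v12])
  -- The images were accumulated in reverse order; one more reversal gives the encoding that the
  -- original construction expects.
  have e3 := (Computes.moveRev (O := noOracle) (G := 20) _ (a := 13) (b := 8) (by decide)
    (by omega) (by omega) (Function.update_self 13 ((keys.map f).flatten.reverse ++
      (Function.update (Function.update v 3 r) 6 κ) 13)
      (Function.update (Function.update (Function.update v 3 r) 6 κ) 2 []))).congr_right
    (v₂ := Function.update (Function.update (Function.update (Function.update v 3 r) 6 κ) 2 []) 8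
      (keys.map f).flatten) (by
      funext i
      clear e1 e2 hF hC hf hkeys
      simp only [Function.update_apply]
      split_ifs <;> simp_all)
  have e4 := Computes.call (O := noOracle) (G := 20) (z := 14) (dst := 0) (P := PC)
    (rs := [0, 1, 8, 3]) (Function.update (Function.update (Function.update
      (Function.update v 3 r) 6 κ) 2 []) 8 (keys.map f).flatten) (out := out) (T := TC)
    (by simpa [v0, v1] using hC) (by simpa using v14) (by omega) (by simp)
  have e5 := Computes.prepend (O := noOracle) (G := 20) (Function.update (Function.update
      (Function.update (Function.update (Function.update v 3 r) 6 κ) 2 []) 8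
      (keys.map f).flatten) 0 out) (a := 6) (b := 0) (c := 9) (by decide)
    (by decide) (by decide) (by omega) (by omega) (by omega) (by simpa using v9)
  have e := ((e1.seq (e2.seq (e3.seq (e4.seq e5)))).congr_left
    (fun i _ => (congrFun hv i).symm)).outputsIn (by omega)
  have h6 : (Function.update (Function.update (Function.update (Function.update
      (Function.update v 3 r) 6 κ) 2 []) 8 (keys.map f).flatten) 0 out) 6 = κ := by simp
  rw [Function.update_self, Function.update_self, h6] at e
  refine e.mono ?_
  simp [v0, v1, v13, hκ, hflat, add_assoc]
  omega

end Prog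

theorem IsKeySet.map {lam n : ℕ} {L : List (BitStr lam)} (hL : IsKeySet n L)
    (f : Equiv.Perm (BitStr lam)) : IsKeySet n (L.map f) :=
  ⟨hL.1.map f.injective, (List.length_map _).trans hL.2⟩

/-- The first `a` bits of a bit string of length `a + b`. -/
def BitStr.fst {a b : ℕ} (x : BitStr (a + b)) : BitStr a :=
  ⟨x.1.take a, by rw [List.length_take, x.2]; omega⟩

/-- The last `b` bits of a bit string of length `a + b`. -/
def BitStr.snd {a b : ℕ} (x : BitStr (a + b)) : BitStr b :=
  ⟨x.1.drop a, by rw [List.length_drop, x.2]; omega⟩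

theorem BitStr.fst_append_snd {a b : ℕ} (x : BitStr (a + b)) : x.fst.1 ++ x.snd.1 = x.1 :=
  List.take_append_drop a x.1

theorem BitStr.fst_eq {a b : ℕ} {x : BitStr (a + b)} {y : BitStr a} {z : List Bool}
    (h : x.1 = y.1 ++ z) : x.fst = y :=
  Subtype.ext (by simp only [BitStr.fst, h, List.take_left' y.2])

theorem BitStr.snd_eq {a b : ℕ} {x : BitStr (a + b)} {y : List Bool} (hy : y.length = a)
    {z : BitStr b} (h : x.1 = y ++ z.1) : x.snd = z :=
  Subtype.ext (by simp only [BitStr.snd, h, List.drop_left' hy])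

/-- The filter `B` with every key `x` replaced by `F_κ(x)`. -/
noncomputable def BloomFilter.permute {n m : ℕ → ℕ} (B : BloomFilter n m) (F : KeyedPermutation) :
    BloomFilter n (fun lam => m lam + lam) where
  params := B.params
  coins lam := lam + B.coins lam
  secret lam := lam
  construct lam L r :=
    ⟨r.fst.1 ++ (B.construct lam (L.map (F.perm lam r.fst.1)) r.snd).1, by
      rw [List.length_append, r.fst.2, List.Vector.length_val]; omega⟩
  query lam st x :=
    B.query lam ⟨st.1.drop lam, by rw [List.length_drop, st.2]; omega⟩
      (F.perm lam (st.1.take lam) x)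
  secret_le lam := Nat.le_add_left _ _
  bounded := by
    obtain ⟨p, hp⟩ := B.bounded
    -- The summand `.X` pays for the `lam` additional coins that form the key.
    refine ⟨p + .X, fun lam => ?_⟩
    have := hp lam
    simp only [Polynomial.eval_add, Polynomial.eval_X]
    omega
  construct_polyTime := by
    obtain ⟨PF, pF, hF⟩ := F.polyTime
    obtain ⟨PC, pC, hC⟩ := B.construct_polyTime
    obtain ⟨pB, hB⟩ := B.bounded
    -- The bound of `permutedConstruct_outputsIn` with `lam` and the set size both replaced by `x =
    -- lam + n lam`, so that `x * x` covers the length of the encoded set.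
    obtain ⟨q, hq⟩ : IsPolynomial fun x => 18 * x + 7 +
        x * (14 * x + callCost PF.width 2 (x + x) (pF.eval (x + x)) + 5) + 4 * (x * x) +
        callCost PC.width 4 (x + pB.eval x + x * x + pB.eval x) (pC.eval x) := by
      have := IsPolynomial.id
      repeat' first | assumption | apply IsPolynomial.add | apply IsPolynomial.callCost |
        apply IsPolynomial.eval | apply IsPolynomial.mul | apply IsPolynomial.const
    refine ⟨Prog.permutedConstruct PF PC, q, fun lam L r hL => ?_⟩
    rw [← BitStr.fst_append_snd r, ← hq]
    refine (Prog.permutedConstruct_outputsIn (f := F.toFun r.fst.1)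
      (TF := pF.eval (lam + lam)) (TC := pC.eval (lam + n lam)) r.fst.2
      (fun x hx => length_of_mem_keyStrings hx) (F.length_eq _) (fun x hx => ?_) ?_).mono ?_
    · have := hF r.fst.1 x
      rwa [hx, r.fst.2] at this
    · rw [← encodeKeys_map_perm]
      exact hC lam _ r.snd (hL.map _)
    · have h1 : lam ≤ lam + n lam := Nat.le_add_right _ _
      have h2 : L.length ≤ lam + n lam := by rw [hL.2]; omega
      have h3 : pF.eval (lam + lam) ≤ pF.eval (lam + n lam + (lam + n lam)) :=
        pF.monotone_eval_nat (by omega)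
      rw [length_keyStrings, r.snd.2]
      obtain ⟨h4, h5⟩ := hB lam
      have h6 : L.length * lam ≤ (lam + n lam) * (lam + n lam) := Nat.mul_le_mul h2 h1
      have h7 := callCost_mono (w := PF.width) (k := 2) (Nat.add_le_add h1 h1) h3
      beta_reduce
      gcongr
      exact callCost_mono (by omega) le_rfl
  query_polyTime := by
    obtain ⟨PF, pF, hF⟩ := F.polyTime
    obtain ⟨PQ, pQ, hQ⟩ := B.query_polyTime
    obtain ⟨pB, hB⟩ := B.bounded
    -- Here `x` stands for `lam + n lam + (m lam + lam)`, which bounds every size that occurs.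
    obtain ⟨q, hq⟩ : IsPolynomial fun x => 10 * x + 3 +
        callCost PF.width 2 (x + x) (pF.eval (x + x)) +
        callCost PQ.width 4 (x + pB.eval x + x + x) (pQ.eval x) := by
      have := IsPolynomial.id
      repeat' first | assumption | apply IsPolynomial.add | apply IsPolynomial.callCost |
        apply IsPolynomial.eval | apply IsPolynomial.mul | apply IsPolynomial.const
    refine ⟨Prog.permutedQuery PF PQ, q, fun lam st x => ?_⟩
    have hst : st.1 = st.1.take lam ++ st.1.drop lam := (List.take_append_drop lam st.1).symm
    have hκ : (st.1.take lam).length = lam := by rw [List.length_take, st.2]; omega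
    have hσ : (st.1.drop lam).length = m lam := by rw [List.length_drop, st.2]; omega
    rw [← hq]
    nth_rw 1 [hst]
    refine (Prog.permutedQuery_outputsIn (TF := pF.eval (lam + lam))
      (TQ := pQ.eval (lam + n lam + m lam)) (σ := st.1.drop lam) hκ x.2 (y := F.toFun (st.1.take lam) x.1) ?_
      (hQ lam ⟨st.1.drop lam, hσ⟩ (F.perm lam (st.1.take lam) x))
      ((F.length_eq _ _).trans x.2)).mono ?_
    · have := hF (st.1.take lam) x.1
      rwa [x.2, hκ] at this
    · have h3 : pF.eval (lam + lam) ≤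
          pF.eval (lam + n lam + (m lam + lam) + (lam + n lam + (m lam + lam))) :=
        pF.monotone_eval_nat (by omega)
      have h4 := (hB lam).1
      have h5 : pB.eval (lam + n lam) ≤ pB.eval (lam + n lam + (m lam + lam)) :=
        pB.monotone_eval_nat (by omega)
      have h6 : pQ.eval (lam + n lam + m lam) ≤ pQ.eval (lam + n lam + (m lam + lam)) :=
        pQ.monotone_eval_nat (by omega)
      refine Nat.add_le_add (Nat.add_le_add (by omega) (callCost_mono (by omega) h3))
        (callCost_mono (by omega) h6)

section Permute

variable {n m : ℕ → ℕ} {B : BloomFilter n m} {F : KeyedPermutation}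

theorem BloomFilter.construct_permute {lam : ℕ} {L : List (BitStr lam)} {κ : BitStr lam}
    {r : BitStr (B.coins lam)} {r' : BitStr ((B.permute F).coins lam)} (h : r'.1 = κ.1 ++ r.1) :
    ((B.permute F).construct lam L r').1 =
      κ.1 ++ (B.construct lam (L.map (F.perm lam κ.1)) r).1 := by
  have h₁ : BitStr.fst (a := lam) r' = κ := BitStr.fst_eq h
  have h₂ : BitStr.snd (a := lam) r' = r := BitStr.snd_eq κ.2 h
  simp only [BloomFilter.permute, h₁, h₂]

theorem BloomFilter.query_permute {lam : ℕ} {x κ : BitStr lam} {σ : BitStr (m lam)}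
    {st : BitStr (m lam + lam)} (h : st.1 = κ.1 ++ σ.1) :
    (B.permute F).query lam st x = B.query lam σ (F.perm lam κ.1 x) := by
  have h₁ : st.1.take lam = κ.1 := by rw [h, List.take_left' κ.2]
  have h₂ : st.1.drop lam = σ.1 := by rw [h, List.drop_left' κ.2]
  simp only [BloomFilter.permute, h₁, h₂]
  rfl

theorem BloomFilter.isPermuted_permute : (B.permute F).IsPermuted F B :=
  fun _ => ⟨rfl, rfl, fun _ => ⟨fun _ _ _ => construct_permute, fun _ _ _ => query_permute⟩⟩

end Permute

/-! ## Simulation of an attack by a distinguisher -/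

/-- The action of `f` on strings; strings of a length other than `n` are fixed. -/
def permString {n : ℕ} (f : Equiv.Perm (BitStr n)) (x : List Bool) : List Bool :=
  if h : x.length = n then (f ⟨x, h⟩).1 else x

/-- Fixing the strings of other lengths makes this unconditional, as `Computes.mapKeys` requires;
the oracle itself answers such strings by `[]`. -/
theorem length_permString {n : ℕ} (f : Equiv.Perm (BitStr n)) (x : List Bool) :
    (permString f x).length = x.length := by
  unfold permString
  split_ifs with h
  · rw [(f ⟨x, h⟩).2, h]
  · rfl

theorem permOracle_forward {n : ℕ} (f : Equiv.Perm (BitStr n)) (x : List Bool) :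
    permOracle f .forward x = if x.length = n then permString f x else [] := by
  by_cases h : x.length = n <;> simp [permOracle, permString, h]

/-! ### Recording and answering the queries of an attack -/

/-- Add a query to the list `keys` of keys if it is a key submitted to the filter. -/
def recordQuery (lam : ℕ) (keys : List (List Bool)) (q : FilterOracle × List Bool) :
    List (List Bool) :=
  match q.1 with
  | .query => if q.2.length = lam then q.2 :: keys else keys
  | .state => keys

/-- All keys submitted to the filter according to the log, and those in `keys`. -/
def recordLog (lam : ℕ) (keys : List (List Bool)) (l : List (FilterOracle × List Bool)) :
    List (List Bool) :=
  l.foldl (recordQuery lam) keys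

theorem mem_recordLog {lam : ℕ} {x : List Bool} (hx : x.length = lam)
    (l : List (FilterOracle × List Bool)) (keys : List (List Bool)) :
    x ∈ recordLog lam keys l ↔ x ∈ keys ∨ (FilterOracle.query, x) ∈ l := by
  unfold recordLog
  induction l generalizing keys with
  | nil => simp
  | cons q l ih =>
    obtain ⟨i, y⟩ := q
    rw [List.foldl_cons, ih]
    cases i
    · simp only [recordQuery, List.mem_cons, Prod.mk.injEq, true_and]
      split_ifs with hy
      · rw [List.mem_cons]; tauto
      · have : x ≠ y := fun h => hy (h ▸ hx)
        tauto
    · simp [recordQuery]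

theorem length_of_mem_recordLog {lam : ℕ} (l : List (FilterOracle × List Bool))
    {keys : List (List Bool)} (hkeys : ∀ x ∈ keys, x.length = lam) :
    ∀ x ∈ recordLog lam keys l, x.length = lam := by
  unfold recordLog
  induction l generalizing keys with
  | nil => exact hkeys
  | cons q l ih =>
    obtain ⟨i, y⟩ := q
    refine ih ?_
    cases i
    · simp only [recordQuery]
      split_ifs with hy
      · simpa [hy] using hkeys
      · exact hkeys
    · exact hkeys

theorem length_recordLog_le (lam : ℕ) (l : List (FilterOracle × List Bool))
    (keys : List (List Bool)) : (recordLog lam keys l).length ≤ keys.length + l.length := by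
  unfold recordLog
  induction l generalizing keys with
  | nil => simp
  | cons q l ih =>
    rw [List.foldl_cons]
    refine (ih _).trans ?_
    have : (recordQuery lam keys q).length ≤ keys.length + 1 := by
      unfold recordQuery
      split
      · split_ifs <;> simp
      · simp
    rw [List.length_cons]
    omega

/-- Answer the query in register `r` to a filter with state in register `17` and public parameters
in register `5`, and record it in register `15`. -/
def Prog.simulateQuery (PQ : Prog Empty) (G r : ℕ) : Prog PermOracle :=
  .seq (.copy 12 r) (.seq (.copy 11 r) (.seq (.ask .forward 12)
    (.cond 12
      (.seq (.prepend 11 10 15) (.seq (.call PQ G 14 [0, 5, 17, 12] r) (.copy 12 14)))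
      (.seq (.prepend 11 10 15) (.seq (.call PQ G 14 [0, 5, 17, 12] r) (.copy 12 14)))
      (.seq (.copy 11 14) (.seq (.copy r 14) (.push r false))))))

/-- Since `lam` is positive, the answer of the permutation oracle is empty exactly for strings
outside the universe, so testing it for emptiness decides membership. Registers `11` and `12` end up
empty again, which restores the assumptions for the next query. -/
theorem Computes.simulateQuery {lam : ℕ} (hlam : 0 < lam) (f : Equiv.Perm (BitStr lam)) {G r : ℕ}
    (hr : 20 ≤ r) (hG : r < G) {PQ : Prog Empty} {params σ x : List Bool}
    {dec : List Bool → Bool} {TQ : ℕ}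
    (hQ : ∀ y, y.length = lam → PQ.OutputsIn [unary lam, params, σ, y] [dec y] TQ) (v : Store)
    (v0 : v 0 = unary lam) (v5 : v 5 = params) (v17 : v 17 = σ) (v10 : v 10 = [])
    (v11 : v 11 = []) (v12 : v 12 = []) (v14 : v 14 = []) (vr : v r = x) :
    Computes (permOracle f) G (.simulateQuery PQ G r) v
      (2 * x.length + 8 * lam + 10 +
        callCost PQ.width 4 (lam + params.length + σ.length + lam) TQ)
      (Function.update (Function.update v 15 (if x.length = lam then x ++ v 15 else v 15)) r
        [if x.length = lam then dec (permString f x) else false]) := by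
  have r0 : r ≠ 0 := by omega
  have r5 : r ≠ 5 := by omega
  have r10 : r ≠ 10 := by omega
  have r11 : r ≠ 11 := by omega
  have r12 : r ≠ 12 := by omega
  have r14 : r ≠ 14 := by omega
  have r15 : r ≠ 15 := by omega
  have r17 : r ≠ 17 := by omega
  have e1 := Computes.copy (O := permOracle f) (G := G) v 12 hG
  have e2 := Computes.copy (O := permOracle f) (G := G) (Function.update v 12 (v r)) 11 hG
  have e3 := Computes.ask (O := permOracle f) (G := G) (Function.update (Function.update v 12 (v r))
    11 (Function.update v 12 (v r) r)) PermOracle.forward (r := 12) (by omega)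
  by_cases hx : x.length = lam
  · have hy : (permString f x).length = lam := (length_permString f x).trans hx
    replace e3 := e3.congr_right (v₂ := Function.update (Function.update v 12 (permString f x))
      11 x) (by
        funext i
        simp only [Function.update_apply, permOracle_forward]
        split_ifs <;> simp_all)
    have e4 := Computes.prepend (O := permOracle f) (G := G)
      (Function.update (Function.update v 12 (permString f x)) 11 x) (a := 11) (c := 10) (b := 15)
      (by decide) (by decide) (by decide) (by omega) (by omega) (by omega) (by simpa using v10)
    replace e4 := e4.congr_right (v₂ := Function.update (Function.update v 12 (permString f x))
      15 (x ++ v 15)) (by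
        funext i
        clear e1 e2 e3 hQ
        simp only [Function.update_apply]
        split_ifs <;> simp_all)
    have e5 := Computes.call (O := permOracle f) (G := G) (z := 14) (dst := r) (P := PQ)
      (rs := [0, 5, 17, 12]) (Function.update (Function.update v 12 (permString f x))
      15 (x ++ v 15)) (out := [dec (permString f x)]) (T := TQ)
      (by simpa [v0, v5, v17] using hQ _ hy) (by simpa using v14) (by omega)
      (by simp; omega)
    have e6 := Computes.copy (O := permOracle f) (G := G) (Function.update (Function.update
      (Function.update v 12 (permString f x)) 15 (x ++ v 15)) r [dec (permString f x)]) 12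
      (r := 14) (by omega)
    have hne : permString f x ≠ [] := by
      intro h
      rw [h] at hy
      simp at hy
      omega
    refine (e1.seq (e2.seq (e3.seq ((e4.seq (e5.seq e6)).cond_nonempty (by omega)
      (by simpa using hne))))).mono ?_ fun i _ => ?_
    · simp [v0, v5, v17, v14, vr, hx, hy, r12, r14.symm, add_assoc]
      omega
    · clear e1 e2 e3 e4 e5 e6 hQ
      simp only [Function.update_apply, if_pos hx]
      split_ifs <;> simp_all
  · replace e3 := e3.congr_right (v₂ := Function.update v 11 x) (by
        funext i
        simp only [Function.update_apply, permOracle_forward]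
        split_ifs <;> simp_all)
    have e4 := Computes.copy (O := permOracle f) (G := G) (Function.update v 11 x) 11
      (r := 14) (by omega)
    have e5 := Computes.copy (O := permOracle f) (G := G) (Function.update (Function.update v 11 x)
      11 (Function.update v 11 x 14)) r (r := 14) (by omega)
    have e6 := Computes.push (O := permOracle f) (G := G) (Function.update (Function.update
      (Function.update v 11 x) 11 (Function.update v 11 x 14)) r (Function.update (Function.update v
      11 x) 11 (Function.update v 11 x 14) 14)) hG false
    refine (e1.seq (e2.seq (e3.seq ((e4.seq (e5.seq e6)).cond_empty (by omega)
      (by simpa using v12))))).mono ?_ fun i _ => ?_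
    · simp [v14, vr, r12]
      omega
    · clear e1 e2 e3 e4 e5 e6 hQ
      simp only [Function.update_apply, if_neg hx]
      split_ifs <;> simp_all

/-- The simulation of the oracles of an adversary. -/
def Prog.simulateOracle (PQ : Prog Empty) (G : ℕ) : FilterOracle → ℕ → Prog PermOracle
  | .query, r => .simulateQuery PQ G r
  | .state, r => .copy r 17

/-- An instance of `Exec.compile` in which the part of the store that depends on the log is the
record of submitted keys in register `15`. Strings of the attack never exceed `M + c` bits, which
bounds the cost of one simulated call. -/
theorem Exec.simulate {lam : ℕ} (hlam : 0 < lam) (f : Equiv.Perm (BitStr lam)) {K : ℕ}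
    {PQ : Prog Empty} {params σ : List Bool} {dec : List Bool → Bool} {TQ : ℕ}
    (hQ : ∀ y, y.length = lam → PQ.OutputsIn [unary lam, params, σ, y] [dec y] TQ)
    {W : Prog FilterOracle} (hK : W.width ≤ K) {s s' : Store} {c : ℕ}
    {l : List (FilterOracle × List Bool)}
    (h : Exec (filterOracle σ fun x => if x.length = lam then dec (permString f x) else false)
      W s c l s') {M : ℕ} (hM : 1 ≤ M) (hσ : σ.length ≤ M) (hs : ∀ r, (s r).length ≤ M)
    (v : Store) {keys : List (List Bool)}
    (v0 : v 0 = unary lam) (v5 : v 5 = params) (v17 : v 17 = σ) (v10 : v 10 = [])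
    (v11 : v 11 = []) (v12 : v 12 = []) (v14 : v 14 = []) (v15 : v 15 = keys.flatten) :
    Computes (permOracle f) (20 + K) (W.compile 20 (Prog.simulateOracle PQ (20 + K)))
      (Store.append 20 v s)
      (c * (2 * (M + c) + 8 * lam + 10 +
        callCost PQ.width 4 (lam + params.length + σ.length + lam) TQ))
      (Store.append 20 (Function.update v 15 (recordLog lam keys l).flatten) s') := by
  set T := 2 * (M + c) + 8 * lam + 10 +
        callCost PQ.width 4 (lam + params.length + σ.length + lam) TQ with hT
  have main := h.compile (O' := permOracle f) (b := 20) (K := K) (M := M + c) (T := T)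
    (S := Prog.simulateOracle PQ (20 + K))
    (base := fun l => Function.update v 15 (recordLog lam keys l).flatten) (by omega) ?_
    (M₀ := M) [] hK ?_ hs le_rfl
  · simp only [List.nil_append] at main
    refine main.congr_left fun i _ => ?_
    rw [show recordLog lam keys [] = keys from rfl, ← v15, Function.update_eq_self]
  · intro i r l s hr hsM
    set w := Store.append 20 (Function.update v 15 (recordLog lam keys l).flatten) s with hw
    have hwlow (j : ℕ) (hj : j < 20) (hj' : j ≠ 15) : w j = v j := by
      rw [hw, Store.append_of_lt _ _ hj, Function.update_of_ne hj']
    have hw15 : w 15 = (recordLog lam keys l).flatten := by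
      rw [hw, Store.append_of_lt _ _ (by omega), Function.update_self]
    have hlog (q : FilterOracle × List Bool) : recordLog lam keys (l ++ [q]) =
        recordQuery lam (recordLog lam keys l) q := by
      simp [recordLog]
    rw [hlog, ← Store.update_append_add]
    cases i
    · have e := Computes.simulateQuery hlam f (G := 20 + K) (r := 20 + r) (by omega) (by omega) hQ
        w ((hwlow 0 (by omega) (by omega)).trans v0) ((hwlow 5 (by omega) (by omega)).trans v5)
        ((hwlow 17 (by omega) (by omega)).trans v17) ((hwlow 10 (by omega) (by omega)).trans v10)
        ((hwlow 11 (by omega) (by omega)).trans v11) ((hwlow 12 (by omega) (by omega)).trans v12)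
        ((hwlow 14 (by omega) (by omega)).trans v14) (Store.append_add _ _ _ _)
      refine e.mono (by omega) fun i _ => ?_
      congr 1
      rw [hw, Store.update_append_of_lt _ _ (by omega), Function.update_idem,
        Store.append_of_lt _ _ (by omega), Function.update_self]
      congr 2
      simp only [recordQuery]
      split_ifs <;> rfl
    · refine (Computes.copy w (20 + r) (r := 17) (by omega)).mono ?_ fun i _ => ?_
      · rw [hwlow 17 (by omega) (by omega), v17]
        omega
      · rw [hwlow 17 (by omega) (by omega), v17]
        rfl
  · intro i x
    cases i
    · simpa [filterOracle] using hM
    · exact hσ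

/-! ### The program of the distinguisher -/

/-- The advice of the distinguisher: five strings, packed into one. -/
def packAdvice (x₀ x₁ x₂ x₃ x₄ : List Bool) : List Bool :=
  tagged 0 x₀.reverse ++ (tagged 1 x₁.reverse ++ (tagged 2 x₂.reverse ++
    (tagged 3 x₃.reverse ++ tagged 4 x₄.reverse)))

theorem length_packAdvice_le (x₀ x₁ x₂ x₃ x₄ : List Bool) :
    (packAdvice x₀ x₁ x₂ x₃ x₄).length ≤
      6 * (x₀.length + x₁.length + x₂.length + x₃.length + x₄.length) := by
  simp only [packAdvice, List.length_append, length_tagged, List.length_reverse]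
  omega

/-- Pushing bits reverses a string, which undoes the reversal in `packAdvice`. The factor `14` is
the price `2 * 4 + 6` of a bit with the longest tag. -/
theorem Computes.unpack {ι : Type} {O : ι → List Bool → List Bool} {G : ℕ} (hG : 7 ≤ G)
    {x₀ x₁ x₂ x₃ x₄ : List Bool} (v : Store) (v1 : v 1 = packAdvice x₀ x₁ x₂ x₃ x₄)
    (v2 : v 2 = []) (v3 : v 3 = []) (v4 : v 4 = []) (v5 : v 5 = []) (v6 : v 6 = []) :
    Computes O G (.loop 1 (.readTagged 1 [2, 3, 4, 5, 6])) v
      (14 * (x₀.length + x₁.length + x₂.length + x₃.length + x₄.length) + 1)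
      (Function.update (Function.update (Function.update (Function.update (Function.update
        (Function.update v 1 []) 2 x₀) 3 x₁) 4 x₂) 5 x₃) 6 x₄) := by
  have h {r j : ℕ} (hr : r < G) (h1 : 1 ≠ r) (hj : ([2, 3, 4, 5, 6] : List ℕ)[j]? = some r)
      {rest : List Bool} {v' : Store} {T : ℕ} :=
    Computes.loop_readTagged (O := O) (j := j) (T := T) h1 (by omega : 1 < G) hr hj (rest := rest)
      (v' := v')
  refine mono_cost (h (r := 2) (j := 0) (by omega) (by omega) rfl x₀.reverse v v1
    (h (r := 3) (j := 1) (by omega) (by omega) rfl x₁.reverse _ (by simp; rfl)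
    (h (r := 4) (j := 2) (by omega) (by omega) rfl x₂.reverse _ (by simp; rfl)
    (h (r := 5) (j := 3) (by omega) (by omega) rfl x₃.reverse (rest := tagged 4 x₄.reverse) _
      (by simp)
    (h (r := 6) (j := 4) (by omega) (by omega) rfl x₄.reverse (rest := []) _ (by simp)
    ((Computes.loop_done (by omega) (by simp)).congr_right ?_)))))) ?_
  · funext i
    clear h v1
    simp only [ne_eq, Nat.reduceEqDiff, not_false_eq_true, Function.update_of_ne,
      List.reverse_reverse, v2, v3, v4, v5, v6, List.append_nil]
    by_cases h1 : i = 1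
    · simp [h1]
    · simp only [Function.update_apply, h1, if_false]
  · simp only [List.length_reverse]
    omega

/-- Sample the state of the filter for the keys in register `2` and set up the inputs of the
adversary in the registers from `20` on. -/
def Prog.prepareAttack (PC : Prog Empty) (G : ℕ) : Prog PermOracle :=
  .seq (.copy 15 2) (.seq (.copy 18 2) (.seq (.mapKeys (.ask .forward 12)) (.seq (.moveRev 13 8)
    (.seq (.call PC G 14 [0, 5, 8, 6] 17) (.seq (.copy 20 0) (.seq (.copy 21 4)
      (.seq (.copy 22 3) (.copy 23 18))))))))

/-- The record in register `15` starts with the set itself, so a single membership test at the end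
excludes both elements of the set and queried keys. Register `18` keeps another copy for the input
of the attack, because mapping consumes register `2`. -/
theorem Computes.prepareAttack {lam : ℕ} (f : Equiv.Perm (BitStr lam)) {G : ℕ}
    (hG : 24 ≤ G) {PC : Prog Empty} {params adv rA rB σ : List Bool} {keys : List (List Bool)}
    (hkeys : ∀ x ∈ keys, x.length = lam) {TC : ℕ}
    (hC : PC.OutputsIn [unary lam, params, (keys.map (permString f)).flatten, rB] σ TC)
    (v : Store) (v0 : v 0 = unary lam) (v2 : v 2 = keys.flatten) (v3 : v 3 = rA) (v4 : v 4 = adv)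
    (v5 : v 5 = params) (v6 : v 6 = rB) (v8 : v 8 = []) (v10 : v 10 = []) (v11 : v 11 = [])
    (v12 : v 12 = []) (v13 : v 13 = []) (v14 : v 14 = []) (hv : ∀ i, 20 ≤ i → v i = []) :
    Computes (permOracle f) G (.prepareAttack PC G) v
      (keys.length * (14 * lam + 6) + 7 * (keys.length * lam) + lam + adv.length + rA.length + 8 +
        callCost PC.width 4 (lam + params.length + keys.length * lam + rB.length) TC)
      (Store.append 20 (Function.update (Function.update (Function.update (Function.update
        (Function.update v 15 keys.flatten) 18 keys.flatten) 2 []) 8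
        (keys.map (permString f)).flatten) 17 σ)
        fun i => [unary lam, adv, rA, keys.flatten].getD i []) := by
  have hE : keys.flatten.length = keys.length * lam := length_flatten_eq_mul hkeys
  have hE' : (keys.map (permString f)).flatten.length = keys.length * lam := by
    rw [length_flatten_eq_mul (lam := lam), List.length_map]
    intro y hy
    obtain ⟨x, hx, rfl⟩ := List.mem_map.mp hy
    rw [length_permString, hkeys x hx]
  generalize hF : (keys.map (permString f)).flatten = E' at *
  have e1 := Computes.copy (O := permOracle f) (G := G) v 15 (r := 2) (by omega)
  have e2 := Computes.copy (O := permOracle f) (G := G) (Function.update v 15 (v 2)) 18 (r := 2)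
    (by omega)
  have e3 := Computes.mapKeys (O := permOracle f) (G := G) (lam := lam) (f := permString f)
    (R := .ask .forward 12) (T := 1) (by omega) (length_permString f) keys
    (Function.update (Function.update v 15 (v 2)) 18 (Function.update v 15 (v 2) 2))
    (fun w _ hl => by
      have h := Computes.ask (O := permOracle f) (G := G) w .forward (r := 12) (by omega)
      rwa [permOracle_forward, if_pos hl] at h) hkeys (by simp [v0]) (by simp [v2])
    (by simp [v10]) (by simp [v11]) (by simp [v12])
  rw [hF] at e3
  generalize hEE : keys.flatten = E at *
  clear hkeys hF hEE
  replace e3 := e3.congr_right (v₂ := Function.update (Function.update (Function.update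
    (Function.update v 15 E) 18 E) 2 []) 13 E'.reverse) (by simp [v13, v2])
  have e4 := (Computes.moveRev (O := permOracle f) (G := G) (Function.update (Function.update
    (Function.update (Function.update v 15 E) 18 E) 2 []) 13 E'.reverse) (a := 13) (b := 8)
    (by decide) (by omega) (by omega) (u := E'.reverse) (by simp)).congr_right
    (v₂ := Function.update (Function.update (Function.update (Function.update v 15 E) 18 E) 2 [])
      8 E') (by
        funext i
        clear e1 e2 e3 hC
        simp only [Function.update_apply]
        split_ifs <;> simp_all)
  have e5 := Computes.call (O := permOracle f) (G := G) (z := 14) (dst := 17) (P := PC)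
    (rs := [0, 5, 8, 6]) (Function.update (Function.update (Function.update (Function.update v 15 E)
      18 E) 2 []) 8 E') (out := σ) (T := TC)
    (by simpa [v0, v5, v6] using hC) (by simpa using v14) (by omega) (by simp; omega)
  set w := Function.update (Function.update (Function.update (Function.update (Function.update v 15
    E) 18 E) 2 []) 8 E') 17 σ with hw
  have w0 : w 0 = unary lam := by simp [hw, v0]
  have w4 : w 4 = adv := by simp [hw, v4]
  have w3 : w 3 = rA := by simp [hw, v3]
  have w18 : w 18 = E := by simp [hw]
  have e6 := (Computes.copy (O := permOracle f) (G := G) w 20 (r := 0) (by omega))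
  have e7 := (Computes.copy (O := permOracle f) (G := G) (Function.update w 20 (w 0)) 21 (r := 4)
    (by omega))
  have e8 := (Computes.copy (O := permOracle f) (G := G) (Function.update (Function.update w 20
    (w 0)) 21 (Function.update w 20 (w 0) 4)) 22 (r := 3) (by omega))
  have e9 := (Computes.copy (O := permOracle f) (G := G) (Function.update (Function.update
    (Function.update w 20 (w 0)) 21 (Function.update w 20 (w 0) 4)) 22 (Function.update
    (Function.update w 20 (w 0)) 21 (Function.update w 20 (w 0) 4) 3)) 23 (r := 18) (by omega))
  refine (e1.seq (e2.seq (e3.seq (e4.seq (e5.seq (e6.seq (e7.seq (e8.seq e9)))))))).mono ?_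
    fun i _ => ?_
  · simp [w0, w3, w4, w18, v0, v2, v5, v6, hE, hE', add_assoc]
    omega
  · clear e1 e2 e3 e4 e5 e6 e7 e8 e9 hC
    by_cases hi : i < 20
    · rw [Store.append_of_lt _ _ hi, Function.update_of_ne (by omega),
        Function.update_of_ne (by omega), Function.update_of_ne (by omega),
        Function.update_of_ne (by omega)]
    · obtain ⟨j, rfl⟩ : ∃ j, i = 20 + j := ⟨i - 20, by omega⟩
      rw [Store.append_add]
      rcases j with _ | _ | _ | _ | j
      · simp [w0]
      · simp [w4]
      · simp [w3]
      · simp [w18]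
      · have hwj : w (20 + (j + 4)) = [] := by
          rw [hw, Function.update_of_ne (by omega), Function.update_of_ne (by omega),
            Function.update_of_ne (by omega), Function.update_of_ne (by omega),
            Function.update_of_ne (by omega)]
          exact hv _ (by omega)
        rw [Function.update_of_ne (by omega),
          Function.update_of_ne (by omega), Function.update_of_ne (by omega),
          Function.update_of_ne (by omega), hwj]
        rfl

/-- Decide whether the string in register `20` is a false positive that has not been recorded in
register `15`. -/
def Prog.judge (PQ : Prog Empty) (G : ℕ) : Prog PermOracle :=
  .seq (.copy 16 20) (.seq (.copy 12 20) (.seq (.ask .forward 12)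
    (.seq (.cond 12 .rejectMember .rejectMember .skip)
      (.cond 12 (.call PQ G 14 [0, 5, 17, 12] 0) (.call PQ G 14 [0, 5, 17, 12] 0)
        (.copy 0 14)))))

/-- A string of the wrong length gets an empty answer from the permutation oracle, and a recorded
key has its answer erased; what survives in register `12` is the image of a legitimate new key,
ready for the query algorithm. -/
theorem Computes.judge {lam : ℕ} (hlam : 0 < lam) (f : Equiv.Perm (BitStr lam)) {G : ℕ}
    (hG : 21 ≤ G) {PQ : Prog Empty} {params σ k : List Bool} {dec : List Bool → Bool} {TQ : ℕ}
    (hQ : ∀ y, y.length = lam → PQ.OutputsIn [unary lam, params, σ, y] [dec y] TQ)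
    {keys : List (List Bool)} (hkeys : ∀ x ∈ keys, x.length = lam) (v : Store)
    (v0 : v 0 = unary lam) (v5 : v 5 = params) (v17 : v 17 = σ) (v10 : v 10 = [])
    (v11 : v 11 = []) (v14 : v 14 = []) (v15 : v 15 = keys.flatten) (v20 : v 20 = k) :
    ∃ v', Computes (permOracle f) G (.judge PQ G) v
      (2 * k.length + keys.length * (7 * lam + 9) + 7 +
        callCost PQ.width 4 (lam + params.length + σ.length + lam) TQ) v' ∧
      v' 0 = if k.length = lam ∧ k ∉ keys then [dec (permString f k)] else [] := by
  have e1 := Computes.copy (O := permOracle f) (G := G) v 16 (r := 20) (by omega)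
  have e2 := Computes.copy (O := permOracle f) (G := G) (Function.update v 16 (v 20)) 12 (r := 20)
    (by omega)
  have e3 := (Computes.ask (O := permOracle f) (G := G) (Function.update (Function.update v 16
    (v 20)) 12 (Function.update v 16 (v 20) 20)) PermOracle.forward (r := 12)
    (by omega)).congr_right (v₂ := Function.update (Function.update v 16 k) 12
      (if k.length = lam then permString f k else [])) (by simp [permOracle_forward, v20])
  by_cases hk : k.length = lam
  · rw [if_pos hk] at e3
    have hy : (permString f k).length = lam := (length_permString f k).trans hk
    have hne : permString f k ≠ [] := by
      intro h
      rw [h] at hy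
      simp at hy
      omega
    have e4 := (Computes.rejectMember (O := permOracle f) (G := G) (by omega) hlam hk keys
      (Function.update (Function.update v 16 k) 12 (permString f k)) hkeys (by simp [v15]) (by simp)
      (by simp [v10]) (by simp [v11]) (by simp [v14])).cond_nonempty (R := .skip) (r := 12)
      (by omega) (by simpa using hne)
    by_cases hmem : k ∈ keys
    · rw [if_pos hmem] at e4
      have e5 := (Computes.copy (O := permOracle f) (G := G) (Function.update (Function.update
        (Function.update (Function.update v 16 k) 12 (permString f k)) 15 []) 12 []) 0 (r := 14)
        (by omega)).cond_empty (P := .call PQ G 14 [0, 5, 17, 12] 0)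
        (Q := .call PQ G 14 [0, 5, 17, 12] 0) (r := 12) (by omega) (by simp)
      refine ⟨_, (e1.seq (e2.seq (e3.seq (e4.seq e5)))).mono_cost ?_, ?_⟩
      · simp [v20, v14]
        omega
      · simp [hmem, v14]
    · rw [if_neg hmem] at e4
      simp only [Function.update_self] at e4
      have e5 := (Computes.call (O := permOracle f) (G := G) (z := 14) (dst := 0) (P := PQ)
        (rs := [0, 5, 17, 12]) (Function.update (Function.update (Function.update (Function.update
          v 16 k) 12 (permString f k)) 15 []) 12 (permString f k)) (out := [dec (permString f k)])
        (T := TQ) (by simpa [v0, v5, v17] using hQ _ hy) (by simpa using v14) (by omega)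
        (by simp; omega)).cond_nonempty (R := .copy 0 14) (r := 12) (by omega) (by simpa using hne)
      refine ⟨_, (e1.seq (e2.seq (e3.seq (e4.seq e5)))).mono_cost ?_, ?_⟩
      · simp [v20, v0, v5, v17, hy, add_assoc]
        omega
      · simp [hk, hmem]
  · rw [if_neg hk] at e3
    have e4 := (Computes.skip (O := permOracle f) (G := G) (Function.update (Function.update v 16 k)
      12 [])).cond_empty (P := .rejectMember) (Q := .rejectMember) (r := 12) (by omega) (by simp)
    have e5 := (Computes.copy (O := permOracle f) (G := G) (Function.update (Function.update v 16 k)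
      12 []) 0 (r := 14) (by omega)).cond_empty (P := .call PQ G 14 [0, 5, 17, 12] 0)
        (Q := .call PQ G 14 [0, 5, 17, 12] 0) (r := 12) (by omega) (by simp)
    refine ⟨_, (e1.seq (e2.seq (e3.seq (e4.seq e5)))).mono_cost ?_, ?_⟩
    · simp [v20, v14]
      omega
    · simp [hk, v14]

/-- The distinguisher that runs the attack `W` against the filter with construction algorithm `PC`
and query algorithm `PQ`. It does nothing if its advice is empty. -/
def Prog.distinguish (PC PQ : Prog Empty) (W : Prog FilterOracle) : Prog PermOracle :=
  .cond 1 (.seq (.pop 1) (.seq (.loop 1 (.readTagged 1 [2, 3, 4, 5, 6]))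
    (.seq (.prepareAttack PC (20 + (W.width + 4)))
      (.seq (W.compile 20 (.simulateOracle PQ (20 + (W.width + 4))))
        (.judge PQ (20 + (W.width + 4))))))) .skip .skip

/-- A bound for the running time of the distinguisher: `n` keys are given, the attack takes `c`
steps, `h` is the length of its advice and random bits, `q` that of the parameters and random
bits of the filter, `a` that of its state, and `TC` and `TQ` are the running times of its
algorithms. -/
def distinguishCost (wC wQ lam n c h q a TC TQ : ℕ) : ℕ :=
  3 + 14 * (n * lam + h + q) + (n * (14 * lam + 6) + 7 * (n * lam) + lam + h + 8 +
    callCost wC 4 (lam + n * lam + q) TC) +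
  c * (2 * (1 + a + lam + h + n * lam + c) + 8 * lam + 10 + callCost wQ 4 (lam + q + a + lam) TQ) +
  (2 * (1 + a + lam + h + n * lam + c) + (n + c) * (7 * lam + 9) + 7 +
    callCost wQ 4 (lam + q + a + lam) TQ)

/-- The leading `true` marks advice that describes an attack. The `4` added to the width reserves
registers `20` to `23` for the inputs of the attack even if its program uses fewer registers. -/
theorem Computes.distinguish {lam : ℕ} (hlam : 0 < lam) (f : Equiv.Perm (BitStr lam))
    {PC PQ : Prog Empty} {W : Prog FilterOracle} {params adv rA rB σ : List Bool}
    {keys : List (List Bool)} (hkeys : ∀ x ∈ keys, x.length = lam) {dec : List Bool → Bool}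
    {TC TQ : ℕ}
    (hC : PC.OutputsIn [unary lam, params, (keys.map (permString f)).flatten, rB] σ TC)
    (hQ : ∀ y, y.length = lam → PQ.OutputsIn [unary lam, params, σ, y] [dec y] TQ)
    {c : ℕ} {l : List (FilterOracle × List Bool)} {k : List Bool}
    (hW : W.Run (filterOracle σ fun x => if x.length = lam then dec (permString f x) else false)
      [unary lam, adv, rA, keys.flatten] c l k) :
    ∃ v', Computes (permOracle f) (20 + (W.width + 4)) (.distinguish PC PQ W)
      (fun i => [unary lam, true :: packAdvice keys.flatten rA adv params rB, []].getD i [])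
      (distinguishCost PC.width PQ.width lam keys.length c (adv.length + rA.length)
        (params.length + rB.length) σ.length TC TQ) v' ∧
      v' 0 = if k.length = lam ∧ k ∉ recordLog lam keys l then [dec (permString f k)] else [] := by
  obtain ⟨s', hW, rfl⟩ := hW
  have hE : keys.flatten.length = keys.length * lam := length_flatten_eq_mul hkeys
  set G := 20 + (W.width + 4) with hG
  obtain ⟨v, hv⟩ : ∃ v : Store, v = fun i =>
    [unary lam, true :: packAdvice keys.flatten rA adv params rB, []].getD i [] := ⟨_, rfl⟩
  have v0 : v 0 = unary lam := by rw [hv]; rfl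
  have v1 : v 1 = true :: packAdvice keys.flatten rA adv params rB := by rw [hv]; rfl
  have vi (i : ℕ) (hi : 2 ≤ i) : v i = [] := by
    rw [hv]
    rcases i with _ | _ | _ | i
    · omega
    · omega
    · rfl
    · rfl
  have e1 := Computes.pop (O := permOracle f) (G := G) v (r := 1) (by omega)
  rw [v1, List.tail_cons] at e1
  have e2 := Computes.unpack (O := permOracle f) (G := G) (by omega) (Function.update v 1
    (packAdvice keys.flatten rA adv params rB)) (Function.update_self _ _ _) (by simp [vi])
    (by simp [vi]) (by simp [vi]) (by simp [vi]) (by simp [vi])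
  rw [Function.update_idem] at e2
  set w := Function.update (Function.update (Function.update (Function.update (Function.update
    (Function.update v 1 []) 2 keys.flatten) 3 rA) 4 adv) 5 params) 6 rB with hw
  have wi (i : ℕ) (hi : 7 ≤ i) : w i = [] := by
    rw [hw, Function.update_of_ne (by omega), Function.update_of_ne (by omega),
      Function.update_of_ne (by omega), Function.update_of_ne (by omega),
      Function.update_of_ne (by omega), Function.update_of_ne (by omega), vi i (by omega)]
  have w0 : w 0 = unary lam := by simp [hw, v0]
  have w5 : w 5 = params := by simp [hw]
  have e3 := Computes.prepareAttack f (G := G) (by omega) (adv := adv) (rA := rA) hkeys hC w w0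
    (by simp [hw]) (by simp [hw]) (by simp [hw]) w5 (by simp [hw]) (wi _ (by omega))
    (wi _ (by omega)) (wi _ (by omega)) (wi _ (by omega)) (wi _ (by omega)) (wi _ (by omega))
    fun i hi => wi i (by omega)
  set u := Function.update (Function.update (Function.update (Function.update
        (Function.update w 15 keys.flatten) 18 keys.flatten) 2 []) 8
        (keys.map (permString f)).flatten) 17 σ with hu
  have u0 : u 0 = unary lam := by simp [hu, w0]
  have u5 : u 5 = params := by simp [hu, w5]
  have u17 : u 17 = σ := by simp [hu]
  have u15 : u 15 = keys.flatten := by simp [hu]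
  have u10 : u 10 = [] := by simp [hu, wi]
  have u11 : u 11 = [] := by simp [hu, wi]
  have u12 : u 12 = [] := by simp [hu, wi]
  have u14 : u 14 = [] := by simp [hu, wi]
  set M := 1 + σ.length + lam + (adv.length + rA.length) + keys.length * lam with hM
  have hs₀ (r : ℕ) : ([unary lam, adv, rA, keys.flatten].getD r []).length ≤ M := by
    refine (List.length_getD_le_sum _ r).trans ?_
    simp only [List.map_cons, List.map_nil, List.sum_cons, List.sum_nil, length_unary, hE]
    omega
  have e4 := hW.simulate hlam f hQ (K := W.width + 4) (by omega) (M := M) (by omega) (by omega) hs₀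
    u u0 u5 u17 u10 u11 u12 u14 u15
  have hk : (s' 0).length ≤ M + c := by
    refine hW.length_le (fun i x => ?_) hs₀ 0
    cases i
    · simp [filterOracle]
      omega
    · simp only [filterOracle]
      omega
  set u' := Store.append 20 (Function.update u 15 (recordLog lam keys l).flatten) s' with hu'
  have hu'_low (j : ℕ) (hj : j < 20) (hj' : j ≠ 15) : u' j = u j := by
    rw [hu', Store.append_of_lt _ _ hj, Function.update_of_ne hj']
  obtain ⟨v', e5, hv'⟩ := Computes.judge hlam f (G := G) (k := s' 0) (by omega) hQ
    (length_of_mem_recordLog l hkeys) u'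
    ((hu'_low 0 (by omega) (by omega)).trans u0) ((hu'_low 5 (by omega) (by omega)).trans u5)
    ((hu'_low 17 (by omega) (by omega)).trans u17) ((hu'_low 10 (by omega) (by omega)).trans u10)
    ((hu'_low 11 (by omega) (by omega)).trans u11) ((hu'_low 14 (by omega) (by omega)).trans u14)
    (by rw [hu', Store.append_of_lt _ _ (by omega), Function.update_self])
    (Store.append_add 20 _ s' 0)
  refine ⟨v', ((((e1.seq (e2.seq (e3.seq (e4.seq e5)))).cond_true (Q := .skip) (R := .skip)
    (r := 1) (by omega) (by simp [v1]))).congr_left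
    (fun i _ => (congrFun hv i).symm)).mono_cost ?_, hv'⟩
  -- A query costs a step, so at most `c` keys are added to the record.
  have hlog : (recordLog lam keys l).length ≤ keys.length + c :=
    (length_recordLog_le lam l keys).trans (Nat.add_le_add_left hW.length_log_le _)
  have hlog' := Nat.mul_le_mul_right (7 * lam + 9) hlog
  have hC' : callCost PC.width 4 (lam + params.length + keys.length * lam + rB.length) TC ≤
      callCost PC.width 4 (lam + keys.length * lam + (params.length + rB.length)) TC :=
    callCost_mono (by omega) le_rfl
  have hQ' : callCost PQ.width 4 (lam + params.length + σ.length + lam) TQ ≤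
      callCost PQ.width 4 (lam + (params.length + rB.length) + σ.length + lam) TQ :=
    callCost_mono (by omega) le_rfl
  have hQ'' : c * (2 * (M + c) + 8 * lam + 10 + callCost PQ.width 4 (lam + params.length +
      σ.length + lam) TQ) ≤ c * (2 * (M + c) + 8 * lam + 10 + callCost PQ.width 4 (lam +
        (params.length + rB.length) + σ.length + lam) TQ) :=
    Nat.mul_le_mul_left _ (Nat.add_le_add_left hQ' _)
  unfold distinguishCost
  rw [← hM, hE]
  omega

/-! ### Attacks with all random choices fixed -/

/-- All choices that an attack on the permuted filter of `B` and the filter itself make at random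
or as advice. -/
structure AttackData {n m : ℕ → ℕ} (B : BloomFilter n m) (lam : ℕ) where
  advice : List Bool
  coins : List Bool
  keys : List (BitStr lam)
  filterCoins : BitStr (B.coins lam)

namespace AttackData

variable {n m : ℕ → ℕ} {B : BloomFilter n m} {lam : ℕ}

/-- The inputs of the attack. -/
def inputs (d : AttackData B lam) : List (List Bool) :=
  [unary lam, d.advice, d.coins, encodeKeys d.keys]

/-- The state of the filter for the keys permuted by `f`. -/
def state (d : AttackData B lam) (f : Equiv.Perm (BitStr lam)) : BitStr (m lam) :=
  B.construct lam (d.keys.map f) d.filterCoins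

/-- The oracles of the attack. -/
def oracle (d : AttackData B lam) (f : Equiv.Perm (BitStr lam)) :
    FilterOracle → List Bool → List Bool :=
  filterOracle (d.state f).1 fun x =>
    if h : x.length = lam then B.query lam (d.state f) (f ⟨x, h⟩) else false

/-- The attack `W` finds a false positive when keys are permuted by `f`. -/
def Breaks (W : Prog FilterOracle) (d : AttackData B lam) (f : Equiv.Perm (BitStr lam)) : Prop :=
  ∃ (k : BitStr lam) (c : ℕ) (log : List (FilterOracle × List Bool)),
    W.Run (d.oracle f) d.inputs c log k.1 ∧ k ∉ d.keys ∧ (FilterOracle.query, k.1) ∉ log ∧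
      B.query lam (d.state f) (f k) = true

/-- Everything is bounded by `N`, including the running time of `W`. -/
structure Bounded (W : Prog FilterOracle) (N : ℕ) (d : AttackData B lam) : Prop where
  pos : 0 < lam
  isKeySet : IsKeySet (n lam) d.keys
  card_le : n lam ≤ N
  length_le : d.advice.length + d.coins.length ≤ N
  halts : ∀ (σ : BitStr (m lam)) (g : List Bool → Bool),
    W.HaltsIn (filterOracle σ.1 g) d.inputs N

/-- The query algorithm on strings. -/
def decide (d : AttackData B lam) (f : Equiv.Perm (BitStr lam)) (y : List Bool) : Bool :=
  if h : y.length = lam then B.query lam (d.state f) ⟨y, h⟩ else false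

theorem decide_val (d : AttackData B lam) (f : Equiv.Perm (BitStr lam)) (y : BitStr lam) :
    d.decide f y.1 = B.query lam (d.state f) y := dif_pos y.2

theorem permString_val (f : Equiv.Perm (BitStr lam)) (x : BitStr lam) :
    permString f x.1 = (f x).1 := dif_pos x.2

theorem oracle_eq (d : AttackData B lam) (f : Equiv.Perm (BitStr lam)) :
    d.oracle f = filterOracle (d.state f).1 fun x =>
      if x.length = lam then d.decide f (permString f x) else false := by
  unfold oracle
  congr 1
  funext x
  split_ifs with h
  · exact ((congrArg _ (permString_val f ⟨x, h⟩)).trans (d.decide_val f _)).symm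
  · rfl

theorem encodeKeys_map (L : List (BitStr lam)) (f : Equiv.Perm (BitStr lam)) :
    encodeKeys (L.map f) = ((keyStrings L).map (permString f)).flatten := by
  refine congrArg List.flatten (List.map_map.trans (Eq.trans ?_
    (List.map_map (l := L) (f := Subtype.val) (g := permString f)).symm))
  exact List.map_congr_left fun x _ => (permString_val f x).symm

theorem mem_keyStrings {L : List (BitStr lam)} {x : BitStr lam} :
    x.1 ∈ keyStrings L ↔ x ∈ L :=
  ⟨fun h => by
    obtain ⟨y, hy, hyx⟩ := List.mem_map.mp h
    rwa [← Subtype.ext hyx], fun h => List.mem_map_of_mem h⟩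

/-- The inputs of the distinguisher that runs the attack. -/
def packed (d : AttackData B lam) : List Bool :=
  true :: packAdvice (encodeKeys d.keys) d.coins d.advice (B.params lam) d.filterCoins.1

/-- With all choices fixed the simulation is deterministic, and the judge tests precisely the
conditions in `Breaks`. The running time of the attack enters through some `c' ≤ N`, so the bound is
independent of `f`. -/
theorem distinguish_spec {W : Prog FilterOracle} {N : ℕ} {d : AttackData B lam}
    (hd : d.Bounded W N) {PC PQ : Prog Empty} {TC TQ : ℕ}
    (hC : ∀ L r, IsKeySet (n lam) L → PC.OutputsIn [unary lam, B.params lam, encodeKeys L, r.1]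
      (B.construct lam L r).1 TC)
    (hQ : ∀ st x, PQ.OutputsIn [unary lam, B.params lam, st.1, x.1] [B.query lam st x] TQ)
    (f : Equiv.Perm (BitStr lam)) :
    ∃ c log out, (Prog.distinguish PC PQ W).Run (permOracle f) [unary lam, d.packed, []] c log out ∧
      (∃ c' ≤ N, c ≤ distinguishCost PC.width PQ.width lam (n lam) c'
        (d.advice.length + d.coins.length) ((B.params lam).length + B.coins lam) (m lam) TC TQ) ∧
      (out = [true] ↔ d.Breaks W f) := by
  obtain ⟨c, l, k, hW, hc⟩ := hd.halts (d.state f)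
    fun x => if x.length = lam then d.decide f (permString f x) else false
  obtain ⟨v', h, hv'⟩ := Computes.distinguish hd.pos f (PC := PC) (PQ := PQ) (W := W)
    (params := B.params lam) (adv := d.advice) (rA := d.coins) (rB := d.filterCoins.1)
    (σ := (d.state f).1) (keys := keyStrings d.keys) (fun x hx => length_of_mem_keyStrings hx)
    (dec := d.decide f) (TC := TC) (TQ := TQ) (by
      rw [← encodeKeys_map]
      exact hC _ _ (hd.isKeySet.map f))
    (fun y hy => by
      obtain ⟨y, rfl⟩ : ∃ y' : BitStr lam, y'.1 = y := ⟨⟨y, hy⟩, rfl⟩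
      rw [d.decide_val f]
      exact hQ _ y) hW
  obtain ⟨c₁, l₁, t', he, hc₁, ht'⟩ := h _ fun _ _ => rfl
  refine ⟨c₁, l₁, v' 0, ⟨t', he, ht' 0 (by omega)⟩, ⟨c, hc, ?_⟩, ?_⟩
  · rwa [length_keyStrings, hd.isKeySet.2, d.filterCoins.2, (d.state f).2] at hc₁
  · rw [hv']
    rw [← d.oracle_eq f] at hW
    constructor
    · intro h
      split_ifs at h with hk
      · obtain ⟨hk, hmem⟩ := hk
        rw [mem_recordLog hk, not_or] at hmem
        obtain ⟨k, rfl⟩ : ∃ k' : BitStr lam, k'.1 = k := ⟨⟨k, hk⟩, rfl⟩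
        refine ⟨k, c, l, hW, fun hk' => hmem.1 (mem_keyStrings.mpr hk'), hmem.2, ?_⟩
        have := List.singleton_injective h
        rwa [permString_val, d.decide_val] at this
    · rintro ⟨k', c', l', hW', hk', hl', hq⟩
      -- The run that witnesses the break is the simulated one.
      obtain ⟨rfl, rfl, rfl⟩ := hW.unique hW'
      rw [if_pos, permString_val, d.decide_val, hq]
      refine ⟨k'.2, ?_⟩
      rw [mem_recordLog k'.2, not_or]
      exact ⟨fun h => hk' (mem_keyStrings.mp h), hl'⟩

end AttackData

/-! ### Efficiency of the distinguisher -/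

@[gcongr]
theorem distinguishCost_mono {wC wQ lam n n' c c' h h' q q' a a' TC TC' TQ TQ' : ℕ} (hn : n ≤ n')
    (hc : c ≤ c') (hh : h ≤ h') (hq : q ≤ q') (ha : a ≤ a') (hTC : TC ≤ TC') (hTQ : TQ ≤ TQ') :
    distinguishCost wC wQ lam n c h q a TC TQ ≤
      distinguishCost wC wQ lam n' c' h' q' a' TC' TQ' := by
  have h₁ : callCost wC 4 (lam + n * lam + q) TC ≤ callCost wC 4 (lam + n' * lam + q') TC' :=
    callCost_mono (by gcongr) hTC
  have h₂ : callCost wQ 4 (lam + q + a + lam) TQ ≤ callCost wQ 4 (lam + q' + a' + lam) TQ' :=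
    callCost_mono (by gcongr) hTQ
  unfold distinguishCost
  gcongr

theorem IsPolynomial.distinguishCost {wC wQ : ℕ} {lam n c h q a TC TQ : ℕ → ℕ}
    (hlam : IsPolynomial lam) (hn : IsPolynomial n) (hc : IsPolynomial c) (hh : IsPolynomial h)
    (hq : IsPolynomial q) (ha : IsPolynomial a) (hTC : IsPolynomial TC) (hTQ : IsPolynomial TQ) :
    IsPolynomial fun x => distinguishCost wC wQ (lam x) (n x) (c x) (h x) (q x) (a x) (TC x)
      (TQ x) := by
  unfold _root_.distinguishCost
  repeat' first | assumption | apply IsPolynomial.add | apply IsPolynomial.callCost |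
    apply IsPolynomial.mul | apply IsPolynomial.const

/-- A family of attacks of polynomial size can be run by an efficient distinguisher. -/
theorem exists_distinguisher {n m : ℕ → ℕ} (B : BloomFilter n m) (W : Prog FilterOracle)
    (p : Polynomial ℕ) (data : ∀ lam, Option (AttackData B lam))
    (hdata : ∀ lam, ∀ d ∈ data lam, d.Bounded W (p.eval lam)) :
    ∃ D : Distinguisher, D.Efficient ∧
      ∀ lam, ∀ d ∈ data lam, ∀ f r, D.Accepts lam f r ↔ d.Breaks W f := by
  obtain ⟨PC, pC, hC⟩ := B.construct_polyTime
  obtain ⟨PQ, pQ, hQ⟩ := B.query_polyTime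
  obtain ⟨pB, hB⟩ := B.bounded
  let D : Distinguisher :=
    { prog := Prog.distinguish PC PQ W
      -- Empty advice means that there is no attack for this `lam`. No coins are needed, since those
      -- of the adversary and of the filter are part of the advice.
      advice := fun lam => ((data lam).map AttackData.packed).getD []
      coins := fun _ => 0 }
  have hinputs (lam : ℕ) (d : AttackData B lam) (hd : d ∈ data lam) (r : BitStr (D.coins lam)) :
      D.inputs lam r = [unary lam, d.packed, []] := by
    have hr : r.1 = [] := List.length_eq_zero_iff.mp r.2
    simp only [Distinguisher.inputs, hr]
    simp only [D, Option.mem_def.mp hd, Option.map_some, Option.getD_some]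
  refine ⟨D, ?_, fun lam d hd f r => ?_⟩
  · obtain ⟨q, hq⟩ : IsPolynomial fun lam => distinguishCost PC.width PQ.width lam (p.eval lam)
        (p.eval lam) (p.eval lam) (pB.eval (lam + p.eval lam) + pB.eval (lam + p.eval lam))
        (lam + p.eval lam * lam + (pB.eval (lam + p.eval lam) + pB.eval (lam + p.eval lam)) +
          pC.eval (lam + p.eval lam)) (pC.eval (lam + p.eval lam))
        (pQ.eval (lam + p.eval lam + (lam + p.eval lam * lam +
          (pB.eval (lam + p.eval lam) + pB.eval (lam + p.eval lam)) +
          pC.eval (lam + p.eval lam)))) := by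
      have := IsPolynomial.id
      repeat' first | assumption | apply IsPolynomial.distinguishCost | apply IsPolynomial.add |
        apply IsPolynomial.eval | apply IsPolynomial.mul
    refine ⟨q, fun lam => ?_⟩
    rw [← hq]
    beta_reduce
    cases hd : data lam with
    | none =>
      refine ⟨by simp [D, hd], Nat.zero_le _, fun f r => ?_⟩
      refine ⟨_, _, _, ⟨_, Exec.cond_empty ?_ (Exec.skip _), rfl⟩, ?_⟩
      · simp [Distinguisher.inputs, D, hd]
      · unfold distinguishCost
        omega
    | some d =>
      have hb := hdata lam d hd
      have hB' : (B.params lam).length + B.coins lam ≤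
          pB.eval (lam + p.eval lam) + pB.eval (lam + p.eval lam) := by
        have := hB lam
        have hm : pB.eval (lam + n lam) ≤ pB.eval (lam + p.eval lam) :=
          pB.monotone_eval_nat (Nat.add_le_add_left hb.card_le _)
        omega
      have hTC : pC.eval (lam + n lam) ≤ pC.eval (lam + p.eval lam) :=
        pC.monotone_eval_nat (Nat.add_le_add_left hb.card_le _)
      have hn : n lam * lam ≤ p.eval lam * lam := Nat.mul_le_mul_right _ hb.card_le
      -- The state is an output of the construction, so it is no longer than the inputs and the
      -- running time together.
      have hm : m lam ≤ lam + p.eval lam * lam +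
          (pB.eval (lam + p.eval lam) + pB.eval (lam + p.eval lam)) +
          pC.eval (lam + p.eval lam) := by
        have := (hC lam d.keys d.filterCoins hb.isKeySet).length_le
        simp only [List.map_cons, List.map_nil, List.sum_cons, List.sum_nil, length_unary,
          length_encodeKeys, hb.isKeySet.2, List.Vector.length_val] at this
        omega
      have hTQ : pQ.eval (lam + n lam + m lam) ≤ pQ.eval (lam + p.eval lam + (lam +
          p.eval lam * lam + (pB.eval (lam + p.eval lam) + pB.eval (lam + p.eval lam)) +
          pC.eval (lam + p.eval lam))) :=
        pQ.monotone_eval_nat (Nat.add_le_add (Nat.add_le_add_left hb.card_le _) hm)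
      refine ⟨?_, Nat.zero_le _, fun f r => ?_⟩
      · simp only [D, hd, Option.map_some, Option.getD_some, AttackData.packed, List.length_cons]
        have := length_packAdvice_le (encodeKeys d.keys) d.coins d.advice (B.params lam)
          d.filterCoins.1
        simp only [length_encodeKeys, hb.isKeySet.2, List.Vector.length_val] at this
        have := hb.length_le
        unfold distinguishCost
        omega
      · obtain ⟨c, l, out, hrun, ⟨c', hc', hc⟩, -⟩ := AttackData.distinguish_spec hb
          (hC lam) (hQ lam) f
        rw [hinputs lam d hd r]
        refine ⟨c, l, out, hrun, hc.trans ?_⟩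
        exact distinguishCost_mono hb.card_le hc' hb.length_le hB' hm hTC hTQ
  · obtain ⟨c, l, out, hrun, -, hout⟩ := AttackData.distinguish_spec (hdata lam d hd)
      (hC lam) (hQ lam) f
    rw [← hout, Distinguisher.Accepts, hinputs lam d hd r]
    constructor
    · rintro ⟨c', l', hrun'⟩
      exact (hrun.unique hrun').2.2
    · rintro rfl
      exact ⟨c, l, hrun⟩

/-! ## Countable families of negligible functions -/

/-- A countable family of negligible functions is eventually dominated by a negligible function. -/
theorem exists_negligible_forall_eventually_le {ι : Type*} [Countable ι] (u : ι → ℕ → ℝ)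
    (hu : ∀ i, Negligible (u i)) :
    ∃ v : ℕ → ℝ, Negligible v ∧ (∀ x, 0 ≤ v x) ∧ ∀ i, ∀ᶠ x in atTop, u i x ≤ v x := by
  obtain ⟨code, hcode⟩ := Countable.exists_injective_nat ι
  -- Only finitely many indices have code at most `j`, so from some point on all of these functions
  -- are below `x ^ (-j)`.
  have hN (j : ℕ) : ∃ N : ℕ, ∀ x : ℕ, x ≥ N → ∀ i, code i ≤ j → (x : ℝ) ^ j * u i x ≤ 1 := by
    have hfin : {i | code i ≤ j}.Finite :=
      (Set.finite_Iic j).preimage hcode.injOn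
    have := (hfin.eventually_all (l := atTop) (p := fun i (x : ℕ) => (x : ℝ) ^ j * u i x ≤ 1)).mpr
      fun i _ => ((hu i j).eventually_le_const one_pos)
    obtain ⟨N, hN⟩ := eventually_atTop.mp this
    exact ⟨N, fun x hx i hi => hN x hx i hi⟩
  choose N hN using hN
  -- The largest exponent already valid at `x`; it tends to infinity, so `x ^ (-J x)` is negligible
  -- and eventually dominates each member of the family.
  let J (x : ℕ) : ℕ := Nat.findGreatest (fun j => N j ≤ x) x
  have hJ {j x : ℕ} (hj : j ≤ x) (hx : N j ≤ x) : j ≤ J x ∧ N (J x) ≤ x :=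
    ⟨Nat.le_findGreatest hj hx, Nat.findGreatest_spec (P := fun j => N j ≤ x) hj hx⟩
  refine ⟨fun x => ((x : ℝ) ^ J x)⁻¹, ?_, fun x => by positivity, fun i => ?_⟩
  · rw [Negligible, Asymptotics.superpolynomialDecay_iff_abs_isBoundedUnder _
      tendsto_natCast_atTop_atTop]
    refine fun z => ⟨1, ?_⟩
    rw [eventually_map]
    filter_upwards [eventually_ge_atTop (max 1 (max z (N z)))] with x hx
    have hx1 : (1 : ℝ) ≤ x := by exact_mod_cast (le_max_left _ _).trans hx
    have hz := hJ (j := z) (x := x) (by omega) (by omega)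
    rw [abs_of_nonneg (by positivity), ← div_eq_mul_inv, div_le_one (by positivity)]
    exact pow_le_pow_right₀ hx1 hz.1
  · filter_upwards [eventually_ge_atTop (max 1 (max (code i) (N (code i))))] with x hx
    have hx1 : (1 : ℝ) ≤ x := by exact_mod_cast (le_max_left _ _).trans hx
    have hz := hJ (j := code i) (x := x) (by omega) (by omega)
    have := hN (J x) x hz.2 i hz.1
    rwa [← one_div, le_div_iff₀ (by positivity), mul_comm]

/-- If every selection from a family of bounded sets of reals is negligible, then so is some
uniform bound. -/
theorem exists_negligible_forall_mem_le (S : ℕ → Set ℝ) {C : ℝ} (hC : ∀ x, ∀ y ∈ S x, y ≤ C)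
    (hS : ∀ s : ℕ → ℝ, (∀ x, s x ∈ S x ∨ s x = 0) → Negligible s) :
    ∃ u : ℕ → ℝ, Negligible u ∧ ∀ x, ∀ y ∈ S x, y ≤ u x := by
  -- The supremum need not be attained, but an element above half of it exists when it is positive,
  -- and twice that element is an upper bound.
  have h (x : ℕ) : ∃ s, (s ∈ S x ∨ s = 0) ∧ ∀ y ∈ S x, y ≤ 2 * s := by
    by_cases hpos : ∃ y ∈ S x, 0 < y
    · obtain ⟨y, hy, hy0⟩ := hpos
      have hb : BddAbove (S x) := ⟨C, hC x⟩
      have hsup : y ≤ sSup (S x) := le_csSup hb hy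
      obtain ⟨s, hs, hlt⟩ := exists_lt_of_lt_csSup ⟨y, hy⟩ (show sSup (S x) / 2 < sSup (S x) by
        linarith)
      exact ⟨s, .inl hs, fun z hz => by linarith [le_csSup hb hz]⟩
    · push Not at hpos
      exact ⟨0, .inr rfl, by simpa using hpos⟩
  choose s hs hs' using h
  exact ⟨fun x => 2 * s x, (hS s hs).const_mul 2, hs'⟩

theorem negligible_eval_mul_half_pow (p : Polynomial ℕ) :
    Negligible fun x => ((p.eval x : ℕ) : ℝ) * (1 / 2) ^ x := by
  have h : Negligible fun x => (1 / 2 : ℝ) ^ x := fun k =>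
    tendsto_pow_const_mul_const_pow_of_lt_one k (by norm_num) (by norm_num)
  refine (Asymptotics.SuperpolynomialDecay.polynomial_mul h
    (p.map (Nat.castRingHom ℝ))).congr fun x => ?_
  simp [Polynomial.eval_natCast_map]

/-! ## Countability of programs -/

/-- An encoding of programs by numbers. -/
def Prog.code {ι : Type} (e : ι → ℕ) : Prog ι → ℕ
  | .skip => Nat.pair 0 0
  | .push r b => Nat.pair 1 (Nat.pair r b.toNat)
  | .pop r => Nat.pair 2 r
  | .copy d r => Nat.pair 3 (Nat.pair d r)
  | .ask i r => Nat.pair 4 (Nat.pair (e i) r)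
  | .seq p q => Nat.pair 5 (Nat.pair (p.code e) (q.code e))
  | .cond r p q p' => Nat.pair 6 (Nat.pair r (Nat.pair (p.code e) (Nat.pair (q.code e) (p'.code e))))
  | .loop r p => Nat.pair 7 (Nat.pair r (p.code e))

theorem Prog.code_injective {ι : Type} {e : ι → ℕ} (he : Function.Injective e) :
    Function.Injective (Prog.code e) := by
  intro P
  induction P with
  | skip => intro Q h; cases Q <;> simp [code, Nat.pair_eq_pair] at h ⊢
  | push r b =>
    intro Q h
    cases Q <;> simp [code, Nat.pair_eq_pair] at h ⊢
    rename_i r' b'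
    cases b <;> cases b' <;> simp_all
  | pop r => intro Q h; cases Q <;> simp_all [code, Nat.pair_eq_pair]
  | copy d r => intro Q h; cases Q <;> simp_all [code, Nat.pair_eq_pair]
  | ask i r =>
    intro Q h
    cases Q <;> simp [code, Nat.pair_eq_pair] at h ⊢
    exact ⟨he h.1, h.2⟩
  | seq p q ihp ihq =>
    intro Q h
    cases Q <;> simp [code, Nat.pair_eq_pair] at h ⊢
    exact ⟨ihp h.1, ihq h.2⟩
  | cond r p q p' ihp ihq ihp' =>
    intro Q h
    cases Q <;> simp [code, Nat.pair_eq_pair] at h ⊢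
    exact ⟨h.1, ihp h.2.1, ihq h.2.2.1, ihp' h.2.2.2⟩
  | loop r p ih =>
    intro Q h
    cases Q <;> simp [code, Nat.pair_eq_pair] at h ⊢
    exact ⟨h.1, ih h.2⟩

/-- Lets one negligible function be chosen for all attack programs at once. -/
instance {ι : Type} [Countable ι] : Countable (Prog ι) := by
  obtain ⟨e, he⟩ := Countable.exists_injective_nat ι
  exact (Prog.code_injective he).countable

instance : Countable FilterOracle :=
  Function.Injective.countable (f := fun i : FilterOracle => match i with
    | .query => true
    | .state => false) fun i j h => by cases i <;> cases j <;> simp_all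

instance : Countable (Polynomial ℕ) :=
  Cardinal.mk_le_aleph0_iff.mp (Polynomial.cardinalMk_le_max.trans (by simp))

/-! ## Probabilities -/

section Pr

variable {Ω Ω' : Type}

open Classical in
theorem Pr_eq_sum [Fintype Ω] (E : Ω → Prop) :
    Pr E = (∑ ω, if E ω then (1 : ℝ) else 0) / Fintype.card Ω := by
  rw [Pr, Nat.card_eq_fintype_card, Nat.card_eq_fintype_card, Fintype.card_subtype,
    Finset.sum_boole]

theorem Pr_nonneg [Finite Ω] (E : Ω → Prop) : 0 ≤ Pr E := by
  unfold Pr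
  positivity

theorem Pr_mono [Finite Ω] {E E' : Ω → Prop} (h : ∀ ω, E ω → E' ω) : Pr E ≤ Pr E' := by
  unfold Pr
  gcongr
  exact Nat.card_le_card_of_injective (fun ω : {ω // E ω} => (⟨ω.1, h _ ω.2⟩ : {ω // E' ω}))
    fun x y hxy => Subtype.ext (congrArg (fun z => z.1) hxy)

theorem Pr_le_one [Finite Ω] (E : Ω → Prop) : Pr E ≤ 1 := by
  unfold Pr
  refine div_le_one_of_le₀ ?_ (by positivity)
  exact_mod_cast Nat.card_le_card_of_injective _ Subtype.val_injective

theorem Pr_comp_equiv [Finite Ω] [Finite Ω'] (e : Ω ≃ Ω') (E : Ω' → Prop) :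
    Pr (fun ω => E (e ω)) = Pr E := by
  unfold Pr
  rw [Nat.card_congr e, Nat.card_congr (e.subtypeEquiv fun _ => Iff.rfl)]

theorem Pr_prod [Fintype Ω] [Fintype Ω'] (E : Ω × Ω' → Prop) :
    Pr E = (∑ ω, Pr fun ω' => E (ω, ω')) / Fintype.card Ω := by
  classical
  simp only [Pr_eq_sum]
  rw [← Finset.sum_div, ← Fintype.sum_prod_type', div_div, Fintype.card_prod, Nat.cast_mul,
    mul_comm (Fintype.card Ω : ℝ)]

theorem Pr_prod_le [Fintype Ω] [Nonempty Ω] [Fintype Ω'] {E : Ω × Ω' → Prop} {C : ℝ}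
    (h : ∀ ω, Pr (fun ω' => E (ω, ω')) ≤ C) : Pr E ≤ C := by
  rw [Pr_prod, div_le_iff₀ (by exact_mod_cast Fintype.card_pos)]
  calc _ ≤ ∑ _ω : Ω, C := Finset.sum_le_sum fun ω _ => h ω
    _ = _ := by rw [Finset.sum_const, Finset.card_univ, nsmul_eq_mul, mul_comm]

theorem Pr_prod_eq [Fintype Ω] [Nonempty Ω] [Fintype Ω'] {E : Ω × Ω' → Prop} {C : ℝ}
    (h : ∀ ω, Pr (fun ω' => E (ω, ω')) = C) : Pr E = C := by
  rw [Pr_prod, div_eq_iff (by exact_mod_cast Fintype.card_ne_zero), Finset.sum_congr rfl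
    fun ω _ => h ω, Finset.sum_const, Finset.card_univ, nsmul_eq_mul, mul_comm]

end Pr

/-! ## The bound for uniformly random permutations -/

namespace AttackData

variable {n m : ℕ → ℕ} {B : BloomFilter n m} {lam : ℕ}

theorem card_queried_le (l : List (FilterOracle × List Bool)) (L : List (BitStr lam))
    (s : Finset (BitStr lam)) (hs : ∀ x ∈ s, x ∈ L ∨ (FilterOracle.query, x.1) ∈ l) :
    s.card ≤ L.length + l.length := by
  classical
  have h₁ : (s.filter (· ∈ L)).card ≤ L.length :=
    (Finset.card_le_card fun x hx => List.mem_toFinset.mpr (Finset.mem_filter.mp hx).2).trans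
      (List.toFinset_card_le L)
  have h₂ : (s.filter (· ∉ L)).card ≤ l.length := by
    refine (Finset.card_le_card_of_injOn (t := l.toFinset)
      (fun x : BitStr lam => (FilterOracle.query, x.1)) (fun x hx => ?_)
      fun x _ y _ h => Subtype.ext (Prod.mk.inj h).2).trans (List.toFinset_card_le l)
    obtain ⟨hx, hx'⟩ := Finset.mem_filter.mp hx
    exact List.mem_toFinset.mpr ((hs x hx).resolve_left hx')
  rw [← Finset.card_filter_add_card_filter_not (s := s) (· ∈ L)]
  exact Nat.add_le_add h₁ h₂

theorem oracle_congr (d : AttackData B lam) {f f' : Equiv.Perm (BitStr lam)}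
    (hstate : d.state f' = d.state f) {l : List (FilterOracle × List Bool)}
    (h : ∀ x : BitStr lam, (FilterOracle.query, x.1) ∈ l → f' x = f x) :
    ∀ q ∈ l, d.oracle f q.1 q.2 = d.oracle f' q.1 q.2 := by
  rintro ⟨i, x⟩ hq
  cases i
  · simp only [oracle, filterOracle, hstate]
    split_ifs with hx
    · rw [h ⟨x, hx⟩ hq]
    · rfl
  · simp only [oracle, filterOracle, hstate]

open Classical in
/-- A random permutation for which the attack succeeds has many variants that are
indistinguishable for the attack, and the value of the found key is a random false positive. -/
theorem card_breaks_mul_le {W : Prog FilterOracle} {N : ℕ} {d : AttackData B lam}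
    (hd : d.Bounded W N) :
    (Finset.univ.filter fun f => d.Breaks W f).card * (2 ^ lam - 2 * N) ≤
      (Finset.univ.filter fun q : Equiv.Perm (BitStr lam) × BitStr lam =>
        q.2 ∉ d.keys.map q.1 ∧ B.query lam (d.state q.1) q.2 = true).card := by
  have hb (f : Equiv.Perm (BitStr lam)) (hf : d.Breaks W f) := hf
  choose! k c l hrun hk hl hq using hb
  let known (f : Equiv.Perm (BitStr lam)) (x : BitStr lam) : Prop :=
    x ∈ d.keys ∨ (FilterOracle.query, x.1) ∈ l f
  -- The values of `f` that the attack has no information about; `f (k f)` is one of them.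
  let fresh (f : Equiv.Perm (BitStr lam)) : Finset (BitStr lam) :=
    Finset.univ.filter fun y => ¬ known f (f.symm y)
  have hcard (f : Equiv.Perm (BitStr lam)) (hf : d.Breaks W f) : 2 ^ lam - 2 * N ≤ (fresh f).card := by
    have h₁ := Finset.card_filter_add_card_filter_not (s := (Finset.univ : Finset (BitStr lam)))
      fun y => known f (f.symm y)
    have h₂ : (Finset.univ.filter fun y => known f (f.symm y)).card ≤ 2 * N := by
      rw [← Finset.card_map f.symm.toEmbedding]
      refine (card_queried_le (l f) d.keys _ fun x hx => ?_).trans ?_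
      · obtain ⟨y, hy, rfl⟩ := Finset.mem_map.mp hx
        exact (Finset.mem_filter.mp hy).2
      -- The chosen run is the one guaranteed to halt within `N` steps, so it makes at most `N`
      -- queries; the set contributes at most another `N` known keys.
      · obtain ⟨c', l', k', hrun', hc'⟩ := hd.halts (d.state f) fun x =>
          if h : x.length = lam then B.query lam (d.state f) (f ⟨x, h⟩) else false
        obtain ⟨s', he, hs'⟩ := hrun f hf
        have hlc := he.length_log_le
        obtain ⟨rfl, -, -⟩ := hrun'.unique (hrun f hf)
        have := hd.card_le
        rw [hd.isKeySet.2]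
        omega
    have h₃ : (Finset.univ : Finset (BitStr lam)).card = 2 ^ lam := by
      rw [Finset.card_univ, card_vector, Fintype.card_bool]
    simp only [fresh]
    omega
  -- The transposition moves only the values at `k f` and at the preimage of `y`, and neither point
  -- is known.
  have hvariant (f : Equiv.Perm (BitStr lam)) (hf : d.Breaks W f) (y : BitStr lam)
      (hy : y ∈ fresh f) (x : BitStr lam) (hx : known f x) :
      (Equiv.swap (f (k f)) y * f) x = f x := by
    rw [Equiv.Perm.mul_apply]
    refine Equiv.swap_apply_of_ne_of_ne (fun h => ?_) fun h => ?_
    · obtain rfl := f.injective h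
      exact hx.elim (hk f hf) (hl f hf)
    · refine (Finset.mem_filter.mp hy).2 ?_
      rwa [← h, Equiv.symm_apply_apply]
  have hkeys (f : Equiv.Perm (BitStr lam)) (hf : d.Breaks W f) (y : BitStr lam)
      (hy : y ∈ fresh f) : d.keys.map (Equiv.swap (f (k f)) y * f) = d.keys.map f :=
    List.map_congr_left fun x hx => hvariant f hf y hy x (.inl hx)
  have hstate (f : Equiv.Perm (BitStr lam)) (hf : d.Breaks W f) (y : BitStr lam)
      (hy : y ∈ fresh f) : d.state (Equiv.swap (f (k f)) y * f) = d.state f := by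
    unfold state
    rw [hkeys f hf y hy]
  have hrun' (f : Equiv.Perm (BitStr lam)) (hf : d.Breaks W f) (y : BitStr lam)
      (hy : y ∈ fresh f) :
      W.Run (d.oracle (Equiv.swap (f (k f)) y * f)) d.inputs (c f) (l f) (k f).1 := by
    obtain ⟨s', he, hs'⟩ := hrun f hf
    exact ⟨s', he.congr_oracle (d.oracle_congr (hstate f hf y hy)
      fun x hx => hvariant f hf y hy x (.inr hx)), hs'⟩
  calc _ ≤ ((Finset.univ.filter fun f => d.Breaks W f).sigma fresh).card := by
        rw [Finset.card_sigma, ← smul_eq_mul]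
        exact Finset.card_nsmul_le_sum _ _ _ fun f hf => hcard f (Finset.mem_filter.mp hf).2
    _ ≤ _ := by
        refine Finset.card_le_card_of_injOn
          (fun q => (Equiv.swap (q.1 (k q.1)) q.2 * q.1, q.1 (k q.1))) ?_ ?_
        · rintro ⟨f, y⟩ hfy
          obtain ⟨hf, hy⟩ := Finset.mem_sigma.mp hfy
          replace hf := (Finset.mem_filter.mp hf).2
          refine Finset.mem_filter.mpr ⟨Finset.mem_univ _, ?_, ?_⟩
          · simp only
            rw [hkeys f hf y hy]
            exact fun h => hk f hf ((List.mem_map_of_injective f.injective).mp h)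
          · simp only
            rw [hstate f hf y hy]
            exact hq f hf
        · rintro ⟨f₁, y₁⟩ h₁ ⟨f₂, y₂⟩ h₂ h
          obtain ⟨hf₁, hy₁⟩ := Finset.mem_sigma.mp h₁
          obtain ⟨hf₂, hy₂⟩ := Finset.mem_sigma.mp h₂
          replace hf₁ := (Finset.mem_filter.mp hf₁).2
          replace hf₂ := (Finset.mem_filter.mp hf₂).2
          obtain ⟨hswap, hz⟩ := Prod.mk.inj h
          simp only at hswap hz hy₁ hy₂
          have hr₁ := hrun' f₁ hf₁ y₁ hy₁
          rw [hswap] at hr₁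
          -- Both original runs are also runs against the common variant, so by determinism they
          -- output the same key.
          have hkk : k f₁ = k f₂ := Subtype.ext (hr₁.unique (hrun' f₂ hf₂ y₂ hy₂)).2.2
          -- The variant sends the output key to `y`.
          have hyy : y₁ = y₂ := by
            have := DFunLike.congr_fun hswap (k f₁)
            rw [Equiv.Perm.mul_apply, Equiv.swap_apply_left, hkk, Equiv.Perm.mul_apply,
              Equiv.swap_apply_left] at this
            exact this
          subst hyy
          rw [hz] at hswap
          rw [mul_left_cancel hswap]

end AttackData

theorem Pr_fst {Ω Ω' : Type} [Fintype Ω] [Fintype Ω'] [Nonempty Ω'] (E : Ω → Prop) :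
    Pr (fun ω : Ω × Ω' => E ω.1) = Pr E :=
  (Pr_comp_equiv (Equiv.prodComm Ω' Ω) fun ω : Ω × Ω' => E ω.1).symm.trans
    (Pr_prod_eq fun _ => rfl)

theorem Pr_swap {Ω Ω' : Type} [Finite Ω] [Finite Ω'] (E : Ω × Ω' → Prop) :
    Pr (fun ω : Ω' × Ω => E (ω.2, ω.1)) = Pr E :=
  Pr_comp_equiv (Equiv.prodComm Ω' Ω) E

theorem Pr_prod_mul_le {Ω Ω₁ Ω₂ : Type} [Fintype Ω] [Fintype Ω₁] [Fintype Ω₂] {E : Ω → Ω₁ → Prop}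
    {E' : Ω → Ω₂ → Prop} {x y : ℝ} (h : ∀ a, Pr (E a) * x ≤ y * Pr (E' a)) :
    Pr (fun ω : Ω × Ω₁ => E ω.1 ω.2) * x ≤ y * Pr (fun ω : Ω × Ω₂ => E' ω.1 ω.2) := by
  rw [Pr_prod, Pr_prod, div_mul_eq_mul_div, mul_div_assoc', Finset.sum_mul, Finset.mul_sum]
  exact div_le_div_of_nonneg_right (Finset.sum_le_sum fun a _ => h a) (Nat.cast_nonneg _)

namespace AttackData

variable {n m : ℕ → ℕ} {B : BloomFilter n m} {lam : ℕ}

theorem Pr_breaks_mul_le {W : Prog FilterOracle} {N : ℕ} {d : AttackData B lam}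
    (hd : d.Bounded W N) :
    Pr (d.Breaks W) * (2 ^ lam - 2 * N) ≤
      2 ^ lam * Pr (fun q : Equiv.Perm (BitStr lam) × BitStr lam =>
        q.2 ∉ d.keys.map q.1 ∧ B.query lam (d.state q.1) q.2 = true) := by
  classical
  have h := card_breaks_mul_le hd
  have h' : ((Finset.univ.filter fun f => d.Breaks W f).card : ℝ) * (2 ^ lam - 2 * N) ≤
      (Finset.univ.filter fun q : Equiv.Perm (BitStr lam) × BitStr lam =>
        q.2 ∉ d.keys.map q.1 ∧ B.query lam (d.state q.1) q.2 = true).card := by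
    refine le_trans ?_ (Nat.cast_le.mpr h)
    rw [Nat.cast_mul]
    refine mul_le_mul_of_nonneg_left ?_ (Nat.cast_nonneg _)
    -- Truncated subtraction can only exceed the real difference.
    rw [sub_le_iff_le_add]
    exact_mod_cast le_tsub_add
  have hP : (0 : ℝ) < Fintype.card (Equiv.Perm (BitStr lam)) := by
    exact_mod_cast Fintype.card_pos
  simp only [Pr, Nat.card_eq_fintype_card, Fintype.card_subtype, Fintype.card_prod, card_vector,
    Fintype.card_bool, Nat.cast_mul, Nat.cast_pow, Nat.cast_ofNat]
  rw [div_mul_eq_mul_div, mul_div_assoc', div_le_div_iff₀ hP (by positivity)]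
  calc _ ≤ ((Finset.univ.filter fun q : Equiv.Perm (BitStr lam) × BitStr lam =>
        q.2 ∉ d.keys.map q.1 ∧ B.query lam (d.state q.1) q.2 = true).card : ℝ) *
        (Fintype.card (Equiv.Perm (BitStr lam)) * 2 ^ lam) :=
        mul_le_mul_of_nonneg_right h' (by positivity)
    _ = _ := by ring

/-- Against a uniformly random permutation, an attack succeeds with probability at most
`ε + 4 N / 2 ^ lam`. -/
theorem Pr_breaks_le {ε : ℕ → ℝ} (hB : B.IsBF ε) (hε : 0 ≤ ε lam) (hε1 : ε lam ≤ 1)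
    {W : Prog FilterOracle} {N : ℕ} (hN : 4 * N ≤ 2 ^ lam) {adv rA : List Bool}
    {L : List (BitStr lam)}
    (hd : ∀ r, (⟨adv, rA, L, r⟩ : AttackData B lam).Bounded W N) :
    Pr (fun ω : BitStr (B.coins lam) × Equiv.Perm (BitStr lam) =>
      (⟨adv, rA, L, ω.1⟩ : AttackData B lam).Breaks W ω.2) ≤
      ε lam + 4 * (N * (1 / 2) ^ lam) := by
  have hN' : 4 * (N : ℝ) ≤ 2 ^ lam := by exact_mod_cast hN
  have hU : (0 : ℝ) < 2 ^ lam := by positivity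
  have hUN : (0 : ℝ) < 2 ^ lam - 2 * N := by
    have : (0 : ℝ) ≤ N := Nat.cast_nonneg _
    linarith
  -- Any coins of the filter would do here.
  have hL : IsKeySet (n lam) L := (hd (List.Vector.replicate _ true)).isKeySet
  have hfp : Pr (fun ω : BitStr (B.coins lam) × (Equiv.Perm (BitStr lam) × BitStr lam) =>
      ω.2.2 ∉ L.map ω.2.1 ∧ B.query lam (B.construct lam (L.map ω.2.1) ω.1) ω.2.2 = true) ≤
      ε lam := by
    rw [← Pr_swap]
    -- With `f` and `z` fixed and only the coins random, `z` is independent of the state, so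
    -- soundness for the set `f(L)` applies.
    refine Pr_prod_le fun ⟨f, z⟩ => ?_
    by_cases hz : z ∈ L.map f
    · refine le_trans (le_of_eq ?_) hε
      have : IsEmpty {r : BitStr (B.coins lam) // z ∉ L.map f ∧
        B.query lam (B.construct lam (L.map f) r) z = true} := ⟨fun x => x.2.1 hz⟩
      simp only [Pr]
      rw [Nat.card_of_isEmpty, Nat.cast_zero, zero_div]
    · exact (Pr_mono fun r hr => hr.2).trans ((hB lam _ (hL.map f)).2 z hz)
  have hle : Pr (fun ω : BitStr (B.coins lam) × Equiv.Perm (BitStr lam) =>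
      (⟨adv, rA, L, ω.1⟩ : AttackData B lam).Breaks W ω.2) * (2 ^ lam - 2 * N) ≤
      2 ^ lam * ε lam := by
    refine le_trans ?_ (mul_le_mul_of_nonneg_left hfp hU.le)
    exact Pr_prod_mul_le (E := fun r f => (⟨adv, rA, L, r⟩ : AttackData B lam).Breaks W f)
      (E' := fun r (q : Equiv.Perm (BitStr lam) × BitStr lam) =>
        q.2 ∉ L.map q.1 ∧ B.query lam (B.construct lam (L.map q.1) r) q.2 = true)
      fun r => Pr_breaks_mul_le (hd r)
  rw [← le_div_iff₀ hUN] at hle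
  refine hle.trans ?_
  rw [div_le_iff₀ hUN, one_div, inv_pow]
  have hx : (N : ℝ) * (2 ^ lam)⁻¹ * 2 ^ lam = N := by field_simp
  have hy : (N : ℝ) * (2 ^ lam)⁻¹ ≤ 1 / 4 := by
    rw [← div_eq_mul_inv, div_le_iff₀ hU]
    linarith
  have hN0 : (0 : ℝ) ≤ N := Nat.cast_nonneg _
  -- With `a = N / 2 ^ lam ≤ 1 / 4`, the product of `ε + 4 a` and `2 ^ lam - 2 N` exceeds `ε * 2 ^
  -- lam` by `2 N (1 - ε) + 2 N (1 - 4 a)`.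
  nlinarith [mul_nonneg hN0 (sub_nonneg.mpr hε1), mul_nonneg hN0 (sub_nonneg.mpr hy)]

/-- The advantage of a polynomial-size attack against `F` over the same attack against a random
permutation is negligible, uniformly in the data of the attack. -/
theorem exists_negligible_advantage {F : KeyedPermutation} (hF : F.IsPRP) (B : BloomFilter n m)
    (W : Prog FilterOracle) (p : Polynomial ℕ) :
    ∃ u : ℕ → ℝ, Negligible u ∧ ∀ (lam : ℕ) (d : AttackData B lam), d.Bounded W (p.eval lam) →
      Pr (fun κ : BitStr lam => d.Breaks W (F.perm lam κ.1)) ≤ Pr (d.Breaks W) + u lam := by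
  let S (lam : ℕ) : Set ℝ := {y | ∃ d : AttackData B lam, d.Bounded W (p.eval lam) ∧
    y = |Pr (fun κ : BitStr lam => d.Breaks W (F.perm lam κ.1)) - Pr (d.Breaks W)|}
  have hC (lam : ℕ) : ∀ y ∈ S lam, y ≤ 1 := by
    rintro y ⟨d, -, rfl⟩
    rw [abs_le]
    constructor <;>
    linarith [Pr_nonneg (d.Breaks W), Pr_le_one (d.Breaks W),
      Pr_nonneg fun κ : BitStr lam => d.Breaks W (F.perm lam κ.1),
      Pr_le_one fun κ : BitStr lam => d.Breaks W (F.perm lam κ.1)]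
  -- A selection picks one attack for each `lam`, or none; such a family is run by a single
  -- non-uniform distinguisher, whose advantage is `s`.
  have hS (s : ℕ → ℝ) (hs : ∀ lam, s lam ∈ S lam ∨ s lam = 0) : Negligible s := by
    have hdata (lam : ℕ) : ∃ o : Option (AttackData B lam),
        (∀ d ∈ o, d.Bounded W (p.eval lam)) ∧ (o = none → s lam = 0) ∧ ∀ d ∈ o, s lam =
          |Pr (fun κ : BitStr lam => d.Breaks W (F.perm lam κ.1)) - Pr (d.Breaks W)| := by
      rcases hs lam with ⟨d, hd, hd'⟩ | h0
      · exact ⟨some d, by simpa using hd, by simp, by simpa using hd'⟩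
      · exact ⟨none, by simp, fun _ => h0, by simp⟩
    choose data hb hnone hsome using hdata
    obtain ⟨D, hD, hacc⟩ := exists_distinguisher B W p data hb
    obtain ⟨ν, hν, hle⟩ := hF D hD
    refine hν.trans_abs_le fun lam => ?_
    have hν0 : 0 ≤ ν lam := (abs_nonneg _).trans (hle lam)
    rw [abs_of_nonneg hν0]
    cases ho : data lam with
    | none => rwa [hnone lam ho, abs_zero]
    | some d =>
      have h := hle lam
      simp only [hacc lam d ho] at h
      rw [Pr_fst (Ω' := BitStr (D.coins lam)) fun κ : BitStr lam => d.Breaks W (F.perm lam κ.1),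
        Pr_fst (Ω' := BitStr (D.coins lam)) fun f => d.Breaks W f] at h
      rwa [hsome lam d ho, abs_abs]
  obtain ⟨u, hu, hu'⟩ := exists_negligible_forall_mem_le S hC hS
  refine ⟨u, hu, fun lam d hd => ?_⟩
  have := (le_abs_self _).trans (hu' lam _ ⟨d, hd, rfl⟩)
  linarith

end AttackData

/-! ## Completeness, soundness and security of the permuted filter -/

/-- Concatenation of bit strings. -/
def BitStr.appendEquiv (a b : ℕ) : BitStr a × BitStr b ≃ BitStr (a + b) where
  toFun x := ⟨x.1.1 ++ x.2.1, by rw [List.length_append, x.1.2, x.2.2]⟩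
  invFun x := (x.fst, x.snd)
  left_inv x := Prod.ext (BitStr.fst_eq rfl) (BitStr.snd_eq x.1.2 rfl)
  right_inv x := Subtype.ext x.fst_append_snd

/-- Equality of the numbers of keys has to be assumed: for `lam = 0` every list has the empty
encoding. -/
theorem encodeKeys_inj {lam : ℕ} : ∀ {L L' : List (BitStr lam)}, L.length = L'.length →
    encodeKeys L = encodeKeys L' → L = L'
  | [], [], _, _ => rfl
  | [], _ :: _, h, _ => by simp at h
  | _ :: _, [], h, _ => by simp at h
  | x :: L, y :: L', hl, h => by
    have h' : x.1 ++ encodeKeys L = y.1 ++ encodeKeys L' := h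
    obtain ⟨h₁, h₂⟩ := List.append_inj h' (x.2.trans y.2.symm)
    rw [Subtype.ext h₁, encodeKeys_inj (by simpa using hl) h₂]

section Permute

variable {n m : ℕ → ℕ} {B : BloomFilter n m} {F : KeyedPermutation} {ε : ℕ → ℝ}

theorem BloomFilter.Pr_permute {lam : ℕ} (E : BitStr ((B.permute F).coins lam) → Prop) :
    Pr E = Pr fun ω : BitStr lam × BitStr (B.coins lam) => E (BitStr.appendEquiv _ _ ω) :=
  (Pr_comp_equiv (BitStr.appendEquiv lam (B.coins lam)) E).symm

theorem BloomFilter.query_construct_permute {lam : ℕ} (L : List (BitStr lam)) (κ x : BitStr lam)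
    (r : BitStr (B.coins lam)) :
    (B.permute F).query lam ((B.permute F).construct lam L (BitStr.appendEquiv _ _ (κ, r))) x =
      B.query lam (B.construct lam (L.map (F.perm lam κ.1)) r) (F.perm lam κ.1 x) :=
  query_permute (construct_permute rfl)

/-- Pseudorandomness plays no role: for each fixed `κ` these are the guarantees of `B` for the image
of the set, and injectivity of `F_κ` keeps non-members outside. -/
theorem BloomFilter.IsBF.permute (hB : B.IsBF ε) : (B.permute F).IsBF ε := by
  refine fun lam L hL => ⟨fun x hx => ?_, fun x hx => ?_⟩
  · rw [BloomFilter.Pr_permute]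
    refine Pr_prod_eq fun κ => ?_
    simp only [BloomFilter.query_construct_permute]
    exact (hB lam _ (hL.map _)).1 _ (List.mem_map_of_mem hx)
  · rw [BloomFilter.Pr_permute]
    refine Pr_prod_le fun κ => ?_
    simp only [BloomFilter.query_construct_permute]
    exact (hB lam _ (hL.map _)).2 _ fun h =>
      hx ((List.mem_map_of_injective (F.perm lam κ.1).injective).mp h)

/-- The adversary's coins determine its set, by determinism and unique decoding, so the winning run
concerns the given `L`. Removing `κ` from the memory leaves exactly the state of the original filter
for the permuted keys. -/
theorem BloomFilter.SmashBloom.breaks {A : Adversary} {t : ℕ → ℕ} {lam : ℕ}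
    {rA : BitStr (A.coins lam)} {κ : BitStr lam} {r : BitStr (B.coins lam)}
    (h : (B.permute F).SmashBloom A t lam rA (BitStr.appendEquiv _ _ (κ, r)))
    {L : List (BitStr lam)} (hL : IsKeySet (n lam) L) {c : ℕ} {log : List (Empty × List Bool)}
    (hchoose : A.choose.Run noOracle (A.chooseInputs lam rA) c log (encodeKeys L)) :
    (⟨A.advice lam, rA.1, L, r⟩ : AttackData B lam).Breaks A.attack (F.perm lam κ.1) := by
  obtain ⟨L', hL', ⟨c', log', hchoose'⟩, k, c₁, log₁, hrun, -, hk, hlog, hq⟩ := h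
  obtain rfl : L = L' :=
    encodeKeys_inj (hL.2.trans hL'.2.symm) (hchoose.unique hchoose').2.2
  have hst : ((B.permute F).construct lam L (BitStr.appendEquiv lam (B.coins lam) (κ, r))).1 =
      κ.1 ++ (B.construct lam (L.map (F.perm lam κ.1)) r).1 := construct_permute rfl
  refine ⟨k, c₁, log₁, ?_, hk, hlog, ?_⟩
  · convert hrun using 1
    · unfold AttackData.oracle
      congr 1
      · rw [hst]
        exact (List.drop_left' κ.2).symm
      · funext x
        unfold BloomFilter.answer
        split_ifs with hx
        · exact (query_construct_permute L κ ⟨x, hx⟩ r).symm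
        · rfl
    · rfl
  · exact (query_construct_permute L κ k r).symm.trans hq

/-- The data of an efficient adversary that has chosen its set are of polynomial size. -/
theorem Adversary.Efficient.exists_bound {A : Adversary} (hA : A.Efficient n m) :
    ∃ p : Polynomial ℕ, ∀ lam, 0 < lam → ∀ (rA : BitStr (A.coins lam)) (L : List (BitStr lam)),
      IsKeySet (n lam) L →
      (∃ c log, A.choose.Run noOracle (A.chooseInputs lam rA) c log (encodeKeys L)) →
      ∀ r, (⟨A.advice lam, rA.1, L, r⟩ : AttackData B lam).Bounded A.attack (p.eval lam) := by
  obtain ⟨p, hp⟩ := hA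
  obtain ⟨q, hq⟩ : IsPolynomial fun lam => (lam + 3 * p.eval lam) + 2 * p.eval lam +
      p.eval (lam + (lam + 3 * p.eval lam)) := by
    have := IsPolynomial.id
    repeat' first | assumption | apply IsPolynomial.add | apply IsPolynomial.eval |
      apply IsPolynomial.mul | apply IsPolynomial.const
  refine ⟨q, fun lam hlam rA L hL ⟨c, log, hrun⟩ r => ?_⟩
  obtain ⟨hadv, hcoins, hchoose, hattack⟩ := hp lam
  -- The encoded set has `n lam * lam ≥ n lam` bits and is an output of `choose`: the inputs account
  -- for `lam + 2 * p.eval lam` bits, the running time for the rest.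
  have hn : n lam ≤ lam + 3 * p.eval lam := by
    obtain ⟨c', log', out, hrun', hc'⟩ := hchoose rA
    obtain ⟨rfl, -, rfl⟩ := hrun.unique hrun'
    have := Prog.OutputsIn.length_le ⟨c, log, hrun, hc'⟩
    rw [length_encodeKeys, hL.2] at this
    simp only [Adversary.chooseInputs, List.map_cons, List.map_nil, List.sum_cons, List.sum_nil,
      length_unary, List.Vector.length_val] at this
    have := Nat.le_mul_of_pos_right (n lam) hlam
    omega
  have hpe : p.eval (lam + n lam) ≤ p.eval (lam + (lam + 3 * p.eval lam)) :=
    p.monotone_eval_nat (by omega)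
  rw [← hq]
  exact
    { pos := hlam
      isKeySet := hL
      card_le := by beta_reduce; omega
      length_le := by
        have : rA.1.length = A.coins lam := rA.2
        beta_reduce
        simp only [this]
        omega
      halts := fun σ g => by
        obtain ⟨c', log', out, hrun', hc'⟩ := hattack rA L σ g hL
        exact ⟨c', log', out, hrun', hc'.trans (by beta_reduce; omega)⟩ }

/-- With the adversary's coins fixed, the set is fixed. For each value of the filter's coins,
replacing `F_κ` by a random permutation costs at most `δ`; averaging over these coins leaves the
bound for random permutations. -/
theorem BloomFilter.Pr_smashBloom_le (hB : B.IsBF ε) {A : Adversary} {t : ℕ → ℕ} {lam N : ℕ}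
    (hε : 0 ≤ ε lam) (hε1 : ε lam ≤ 1) (hN : 4 * N ≤ 2 ^ lam)
    (hbound : ∀ (rA : BitStr (A.coins lam)) (L : List (BitStr lam)), IsKeySet (n lam) L →
      (∃ c log, A.choose.Run noOracle (A.chooseInputs lam rA) c log (encodeKeys L)) →
      ∀ r, (⟨A.advice lam, rA.1, L, r⟩ : AttackData B lam).Bounded A.attack N) {δ : ℝ} (hδ : 0 ≤ δ)
    (hadv : ∀ d : AttackData B lam, d.Bounded A.attack N →
      Pr (fun κ : BitStr lam => d.Breaks A.attack (F.perm lam κ.1)) ≤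
        Pr (d.Breaks A.attack) + δ) :
    Pr (fun ω : BitStr (A.coins lam) × BitStr ((B.permute F).coins lam) =>
      (B.permute F).SmashBloom A t lam ω.1 ω.2) ≤ ε lam + (4 * (N * (1 / 2) ^ lam) + δ) := by
  refine Pr_prod_le fun rA => ?_
  rw [BloomFilter.Pr_permute, ← Pr_swap]
  by_cases h : ∃ L : List (BitStr lam), IsKeySet (n lam) L ∧
      ∃ c log, A.choose.Run noOracle (A.chooseInputs lam rA) c log (encodeKeys L)
  · obtain ⟨L, hL, c, log, hchoose⟩ := h
    have hd := hbound rA L hL ⟨c, log, hchoose⟩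
    have hideal := AttackData.Pr_breaks_le hB hε hε1 hN hd
    refine (Pr_mono (E' := fun ω : BitStr (B.coins lam) × BitStr lam =>
      (⟨A.advice lam, rA.1, L, ω.1⟩ : AttackData B lam).Breaks A.attack (F.perm lam ω.2.1))
      fun ω hω => hω.breaks hL hchoose).trans ?_
    have hcard : (0 : ℝ) < Fintype.card (BitStr (B.coins lam)) := by
      exact_mod_cast Fintype.card_pos
    rw [Pr_prod, div_le_iff₀ hcard] at hideal ⊢
    calc _ ≤ ∑ r : BitStr (B.coins lam),
          (Pr ((⟨A.advice lam, rA.1, L, r⟩ : AttackData B lam).Breaks A.attack) + δ) :=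
          Finset.sum_le_sum fun r _ => hadv _ (hd r)
      _ ≤ _ := by
          rw [Finset.sum_add_distrib, Finset.sum_const, Finset.card_univ, nsmul_eq_mul]
          linarith
  -- If `choose` outputs no valid set for these coins, the game cannot be won.
  · refine le_trans (le_of_eq ?_) (add_nonneg hε (by positivity))
    have : IsEmpty {ω : BitStr (B.coins lam) × BitStr lam // (B.permute F).SmashBloom A t lam rA
        (BitStr.appendEquiv lam (B.coins lam) (ω.2, ω.1))} :=
      ⟨fun ⟨ω, L, hL, hc, _⟩ => h ⟨L, hL, hc⟩⟩
    simp only [Pr]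
    rw [Nat.card_of_isEmpty, Nat.cast_zero, zero_div]

end Permute

/-! ### The main theorem -/

theorem theorem2 (F : KeyedPermutation) (hF : F.IsPRP) (n m t : ℕ → ℕ) (ε : ℕ → ℝ)
    (hε : ∀ lam, 0 ≤ ε lam) (B : BloomFilter n m) (hB : B.IsBF ε) :
    ∃ negl : ℕ → ℝ, Negligible negl ∧
      ∃ B' : BloomFilter n (fun lam => m lam + lam),
        B'.IsPermuted F B ∧ B'.IsBF ε ∧ B'.Secure t (fun lam => ε lam + negl lam) := by
  -- Indexing by programs and polynomials alone keeps the family countable; advice and coins of the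
  -- adversary are already covered uniformly.
  choose u hu hadv using fun i : Prog FilterOracle × Polynomial ℕ =>
    AttackData.exists_negligible_advantage hF B i.1 i.2
  obtain ⟨negl, hnegl, hnegl0, hle⟩ := exists_negligible_forall_eventually_le
    (fun i x => 4 * (((i.2.eval x : ℕ) : ℝ) * (1 / 2) ^ x) + |u i x|)
    (fun i => ((negligible_eval_mul_half_pow i.2).const_mul 4).add
      ((hu i).trans_abs_le fun x => (abs_abs _).le))
  refine ⟨negl, hnegl, B.permute F, BloomFilter.isPermuted_permute, hB.permute, fun A hA => ?_⟩
  have hA' : A.Efficient n m := by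
    have : (fun lam => m lam + lam - (B.permute F).secret lam) = m :=
      funext fun lam => Nat.add_sub_cancel (m lam) lam
    rwa [this] at hA
  obtain ⟨p, hp⟩ := hA'.exists_bound (B := B)
  have hsmall : ∀ᶠ lam : ℕ in atTop, 4 * p.eval lam ≤ 2 ^ lam := by
    have h := ((negligible_eval_mul_half_pow p) 0).eventually_le_const
      (show (0 : ℝ) < 1 / 4 by norm_num)
    filter_upwards [h] with lam hlam
    rw [pow_zero, one_mul, one_div, inv_pow, ← div_eq_mul_inv, div_le_iff₀ (by positivity)] at hlam
    have : 4 * ((p.eval lam : ℕ) : ℝ) ≤ 2 ^ lam := by linarith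
    exact_mod_cast this
  filter_upwards [eventually_gt_atTop 0, hsmall, hle (A.attack, p)] with lam hlam hN hbd
  -- The estimate for random permutations needs `ε lam ≤ 1`; otherwise the bound exceeds every
  -- probability.
  by_cases hε1 : ε lam ≤ 1
  · refine (BloomFilter.Pr_smashBloom_le hB (hε lam) hε1 hN (hp lam hlam)
      (abs_nonneg (u (A.attack, p) lam)) fun d hd => ?_).trans (by linarith)
    exact (hadv (A.attack, p) lam d hd).trans (by linarith [le_abs_self (u (A.attack, p) lam)])
  · exact (Pr_le_one _).trans (by linarith [hnegl0 lam])
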